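/- Let $\Omega\subset\mathbb R^d$ be open with a finite conforming mesh $\mathcal T_h$ of (not necessarily convex) polytopal elements $K$, with flat faces $F\in\mathcal F_h$, outward unit normals $\boldsymbol n$ on $\partial K$, and diameters $h_K$ (write $h=h_K$ on $\partial K$). Let $\mathrm c$ be a tensor field and $f$ a function, both integrable on $\Omega$, let $u_D\in L^2(\partial\Omega)$, and let $\rho>0$ be a constant. Let $\boldsymbol V(K)$, $W(K)$ be linear spaces of vector-valued and scalar functions that are $C^1$ in a neighbourhood of $K$, and let $M(F)\subset L^2(F)$ be finite-dimensional, with $L^2(F)$-orthogonal projection $P_M=P_{M(F)}$. Let $\boldsymbol V_h,W_h,M_h$ be the spaces of functions that are, element by element (face by face), in $\boldsymbol V(K),W(K)$ ($M(F)$), and put $\boldsymbol N_h=\{\boldsymbol\nu\in \boldsymbol L^2(\mathcal F_h):\boldsymbol\nu\cdot\boldsymbol n|_F\in M(F)\ \forall F\}$. Write $(\cdot,\cdot)_{\mathcal T_h}=\sum_K\int_K$ and $\langle\cdot,\cdot\rangle_{\partial\mathcal T_h}=\sum_K\int_{\partial K}$. The HDG method with the Lehrenfeld–Schöberl stabilization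 $\tau=\frac{\rho}{h_K}P_{M(F)}$ is: find $(\boldsymbol q_h,u_h,\widehat u_h)\in \boldsymbol V_h\times W_h\times M_h$ such that, for all $(\boldsymbol v,w,\mu)\in \boldsymbol V_h\times W_h\times M_h$, $$(\mathrm c\,\boldsymbol q_h,\boldsymbol v)_{\mathcal T_h}-(u_h,\nabla\cdot \boldsymbol v)_{\mathcal T_h}+\langle\widehat u_h,\boldsymbol v\cdot \boldsymbol n\rangle_{\partial\mathcal T_h}=0,\qquad -(\boldsymbol q_h,\nabla w)_{\mathcal T_h}+\langle\widehat{\boldsymbol q}_h\cdot \boldsymbol n,w\rangle_{\partial\mathcal T_h}=(f,w)_{\mathcal T_h},$$ $$\langle\mu,\widehat{\boldsymbol q}_h\cdot \boldsymbol n\rangle_{\partial\mathcal T_h\setminus\partial\Omega}=0,\qquad \langle\mu,\widehat u_h\rangle_{\partial\Omega}=\langle\mu,u_D\rangle_{\partial\Omega},$$ where $\widehat{\boldsymbol q}_h\cdot \boldsymbol n:=\boldsymbol q_h\cdot \boldsymbol n+\tau(u_h-\widehat u_h)$ on $\partial\mathcal T_h$. **(A)** Assume $\boldsymbol V(K)\cdot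 \boldsymbol n|_F\subset M(F)$ for every face $F$ of every element $K$. 1. For every solution $(\boldsymbol q_h,u_h,\widehat u_h)$ of the HDG method, $\widehat{\boldsymbol q}_h\cdot\boldsymbol n$ is the normal component of a (single-valued) function $\widehat{\boldsymbol q}_h\in \boldsymbol N_h$. 2. For $(\boldsymbol q_h,u_h,\widehat u_h)\in \boldsymbol V_h\times W_h\times M_h$ and $\widehat{\boldsymbol q}_h\in\boldsymbol L^2(\mathcal F_h)$, the relation $\widehat{\boldsymbol q}_h\cdot \boldsymbol n=\boldsymbol q_h\cdot \boldsymbol n+\tau(u_h-\widehat u_h)$ on $\partial\mathcal T_h$ is equivalent to $$\widehat u_h=P_Mu_h+\tfrac h\rho(\boldsymbol q_h-\widehat{\boldsymbol q}_h)\cdot \boldsymbol n\quad\text{on }\partial\mathcal T_h. \qquad (1)$$ When it holds, $\widehat{\boldsymbol q}_h\in \boldsymbol N_h$, and $(\boldsymbol q_h,u_h,\widehat u_h)$ solves the HDG method if and only if $(\boldsymbol q_h,u_h,\widehat{\boldsymbol q}_h)\in \boldsymbol V_h\times W_h\times \boldsymbol N_h$ solves the following system, in which $\widehat u_h$ is eliminated,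 i.e. stands for the right-hand side of (1): for all $\boldsymbol v\in \boldsymbol V_h$, $w\in W_h$, $\boldsymbol\nu\in \boldsymbol N_h$, $$(\mathrm c\,\boldsymbol q_h,\boldsymbol v)_{\mathcal T_h}-(u_h,\nabla\cdot \boldsymbol v)_{\mathcal T_h}+\langle\widehat u_h,\boldsymbol v\cdot \boldsymbol n\rangle_{\partial\mathcal T_h}=0,\quad -(\boldsymbol q_h,\nabla w)_{\mathcal T_h}+\langle\widehat{\boldsymbol q}_h\cdot \boldsymbol n,w\rangle_{\partial\mathcal T_h}=(f,w)_{\mathcal T_h},\quad \langle\widehat u_h,\boldsymbol\nu\cdot \boldsymbol n\rangle_{\partial\mathcal T_h}=\langle u_D,\boldsymbol\nu\cdot \boldsymbol n\rangle_{\partial\Omega}. \qquad (2)$$ 3. For each solution $(\boldsymbol q_h,u_h,\widehat{\boldsymbol q}_h)$ of (2) there is exactly one $\widehat u_h\in M_h$ such that $(\boldsymbol q_h,u_h,\widehat u_h)$ solves the HDG method and $\widehat{\boldsymbol q}_h\cdot \boldsymbol n=\boldsymbol q_h\cdot \boldsymbol n+\tau(u_h-\widehat u_h)$ on $\partial\mathcal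 T_h$. 4. $(\boldsymbol q_h,u_h,\widehat{\boldsymbol q}_h)$ solves (2) if and only if it lies in $\boldsymbol V_h\times W_h\times \boldsymbol N_h$ and, for all $(\boldsymbol v,w,\boldsymbol\nu)\in \boldsymbol V_h\times W_h\times \boldsymbol N_h$, $$\Big[(\mathrm c\,\boldsymbol q_h,\boldsymbol v)_{\mathcal T_h}+\big\langle\tfrac h\rho(\boldsymbol q_h-\widehat{\boldsymbol q}_h)\cdot \boldsymbol n,(\boldsymbol v-\boldsymbol\nu)\cdot \boldsymbol n\big\rangle_{\partial\mathcal T_h}\Big]-\Big[-(\nabla u_h,\boldsymbol v)_{\mathcal T_h}+\langle u_h,\boldsymbol\nu\cdot \boldsymbol n\rangle_{\partial\mathcal T_h}\Big]=-\langle u_D,\boldsymbol\nu\cdot \boldsymbol n\rangle_{\partial\Omega},$$ $$-(\boldsymbol q_h,\nabla w)_{\mathcal T_h}+\langle\widehat{\boldsymbol q}_h\cdot \boldsymbol n,w\rangle_{\partial\mathcal T_h}=(f,w)_{\mathcal T_h}. \qquad (3)$$ **(B)** Let $k\ge0$, $\boldsymbol V(K)=[\mathcal P_k(K)]^d$, $W(K)=\mathcal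 P_{k+1}(K)$, $M(F)=\mathcal P_k(F)$. Then $\boldsymbol V(K)\cdot \boldsymbol n|_F\subset M(F)$ for every face $F$ of every $K$. For $\boldsymbol v\in \boldsymbol V_h$, $\boldsymbol\nu\in \boldsymbol N_h$ there is on each $K$ exactly one discrete weak divergence $\nabla_w\cdot\{\boldsymbol v,\boldsymbol\nu\}\in\mathcal P_{k+1}(K)$ with $$(\nabla_w\cdot\{\boldsymbol v,\boldsymbol\nu\},\varphi)_K=-(\boldsymbol v,\nabla\varphi)_K+\langle\boldsymbol\nu\cdot \boldsymbol n,\varphi\rangle_{\partial K}\quad\forall\varphi\in\mathcal P_{k+1}(K).$$ System (3) is exactly the 2014 Wang–Ye mixed weak Galerkin scheme (with stabilization coefficient $h_K/\rho$): a triple solves (3) if and only if it solves: find $\{\boldsymbol q_h,\widehat{\boldsymbol q}_h\}\in \boldsymbol V_h\times \boldsymbol N_h$ and $u_h\in W_h$ such that, for all $\{\boldsymbol v,\boldsymbol\nu\}\in \boldsymbol V_h\times \boldsymbol N_h$ and $w\in W_h$, $$(\mathrm c\,\boldsymbol q_h,\boldsymbol v)_{\mathcal T_h}+\sum_K\tfrac{h_K}\rho\langle(\boldsymbol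 q_h-\widehat{\boldsymbol q}_h)\cdot \boldsymbol n,(\boldsymbol v-\boldsymbol\nu)\cdot \boldsymbol n\rangle_{\partial K}-(\nabla_w\cdot\{\boldsymbol v,\boldsymbol\nu\},u_h)_{\mathcal T_h}=-\langle u_D,\boldsymbol\nu\cdot \boldsymbol n\rangle_{\partial\Omega},$$ $$(\nabla_w\cdot\{\boldsymbol q_h,\widehat{\boldsymbol q}_h\},w)_{\mathcal T_h}=(f,w)_{\mathcal T_h}.$$ -/

import Mathlib

open MeasureTheory Set
open scoped ENNReal

noncomputable section

namespace HDG

/-- Euclidean space `ℝ^d`. -/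
abbrev E (d : ℕ) : Type := EuclideanSpace ℝ (Fin d)

/-! ### Meshes -/

/-- A (possibly non-convex) flat face: a compact set that spans an affine hyperplane, is the closure
of its relative interior, and whose relative boundary has zero `(d-1)`-dimensional measure.
Every `(d-1)`-dimensional polytope in `ℝ^d` is such a set. -/
structure IsFlatFace {d : ℕ} (F : Set (E d)) : Prop where
  nonempty : F.Nonempty
  isCompact : IsCompact F
  finrank_direction : Module.finrank ℝ (affineSpan ℝ F).direction + 1 = d
  eq_closure : F = closure (intrinsicInterior ℝ F)
  measure_frontier :
    (Measure.euclideanHausdorffMeasure (d - 1) : Measure (E d)) (intrinsicFrontier ℝ F) = 0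

/-- `n` is the outward unit normal to the set `K` on its flat face `F`: near every relative interior
point of `F`, the set `K` is the half-space bounded by the hyperplane of `F` with outward unit
normal `n`. -/
structure IsOutwardUnitNormal {d : ℕ} (K F : Set (E d)) (n : E d) : Prop where
  norm_eq_one : ‖n‖ = 1
  orthogonal : ∀ x ∈ F, ∀ y ∈ F, inner ℝ n (y - x) = 0
  local_halfSpace : ∀ x ∈ intrinsicInterior ℝ F, ∃ ε > 0, ∀ y ∈ Metric.ball x ε,
    (y ∈ K ↔ inner ℝ n (y - x) ≤ 0)

/-- A finite conforming mesh of the open set `Ω ⊆ ℝ^d` by (not necessarily convex) polytopal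
elements. -/
structure Mesh (d : ℕ) (Ω : Set (E d)) where
  Cell : Type
  Face : Type
  [fintypeCell : Fintype Cell]
  [fintypeFace : Fintype Face]
  /-- the closed elements `K` -/
  cell : Cell → Set (E d)
  /-- the closed faces `F` -/
  face : Face → Set (E d)
  /-- the faces of an element -/
  facesOf : Cell → Finset Face
  /-- `normal K F` is the outward unit normal to the element `K` on its face `F` -/
  normal : Cell → Face → E d
  isOpen_domain : IsOpen Ω
  cell_nonempty : ∀ K, (cell K).Nonempty
  cell_isCompact : ∀ K, IsCompact (cell K)
  cell_eq_closure : ∀ K, cell K = closure (interior (cell K))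
  cell_disjoint : Pairwise fun K K' => Disjoint (interior (cell K)) (interior (cell K'))
  closure_domain : closure Ω = ⋃ K, cell K
  face_isFlatFace : ∀ F, IsFlatFace (face F)
  face_disjoint : Pairwise fun F F' =>
    Disjoint (intrinsicInterior ℝ (face F)) (intrinsicInterior ℝ (face F'))
  frontier_cell : ∀ K, frontier (cell K) = ⋃ F ∈ facesOf K, face F
  normal_spec : ∀ K, ∀ F ∈ facesOf K, IsOutwardUnitNormal (cell K) (face F) (normal K F)
  /-- the faces contained in `∂Ω` cover `∂Ω` -/
  frontier_domain : frontier Ω = ⋃ F ∈ {F | face F ⊆ frontier Ω}, face F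
  /-- conformity: a face on `∂Ω` is a face of exactly one element -/
  boundary_face : ∀ F, face F ⊆ frontier Ω → {K | F ∈ facesOf K}.ncard = 1
  /-- conformity: any other face is a face of exactly two elements -/
  interior_face : ∀ F, ¬ face F ⊆ frontier Ω → {K | F ∈ facesOf K}.ncard = 2

attribute [instance] Mesh.fintypeCell Mesh.fintypeFace

variable {d : ℕ} {Ω : Set (E d)}

namespace Mesh

/-- Surface measure on the face `F`. -/
def faceMeasure (T : Mesh d Ω) (F : T.Face) : Measure (E d) :=
  (Measure.euclideanHausdorffMeasure (d - 1) : Measure (E d)).restrict (T.face F)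

/-- The diameter `h_K`. -/
def h (T : Mesh d Ω) (K : T.Cell) : ℝ := Metric.diam (T.cell K)

/-- `F` lies on `∂Ω`. -/
def IsBoundary (T : Mesh d Ω) (F : T.Face) : Prop := T.face F ⊆ frontier Ω

/-- `L²(F)`. -/
abbrev L2 (T : Mesh d Ω) (F : T.Face) : Type := Lp ℝ 2 (T.faceMeasure F)

open Classical in
/-- The trace on `F` of a function, as an element of `L²(F)`. (The `else` branch is never used for
functions that are square integrable on `F`, in particular functions continuous on `F`.) -/
def toL2 (T : Mesh d Ω) (F : T.Face) (g : E d → ℝ) : T.L2 F :=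
  if hg : MemLp g 2 (T.faceMeasure F) then hg.toLp g else 0

/-- `(a, b)_{𝒯_h} = ∑_K ∫_K a b`, for scalar functions given element by element. -/
def volPair (T : Mesh d Ω) (a b : T.Cell → E d → ℝ) : ℝ :=
  ∑ K, ∫ x in T.cell K, a K x * b K x

/-- `(a, b)_{𝒯_h} = ∑_K ∫_K a · b`, for vector functions given element by element. -/
def volPairVec (T : Mesh d Ω) (a b : T.Cell → E d → E d) : ℝ :=
  ∑ K, ∫ x in T.cell K, inner ℝ (a K x) (b K x)

open Classical in
/-- `∑_K ∑_F ∫_F a b`, over the faces `F` of `K` with `p F`, for functions that may take different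
values on the two sides of a face. -/
def facePairOn (T : Mesh d Ω) (p : T.Face → Prop) (a b : T.Cell → T.Face → E d → ℝ) : ℝ :=
  ∑ K, ∑ F ∈ (T.facesOf K).filter p, ∫ x, a K F x * b K F x ∂(T.faceMeasure F)

/-- `⟨a, b⟩_{∂𝒯_h}`. -/
def facePair (T : Mesh d Ω) (a b : T.Cell → T.Face → E d → ℝ) : ℝ :=
  T.facePairOn (fun _ => True) a b

/-- `⟨a, b⟩_{∂𝒯_h ∖ ∂Ω}`. -/
def facePairInt (T : Mesh d Ω) (a b : T.Cell → T.Face → E d → ℝ) : ℝ :=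
  T.facePairOn (fun F => ¬ T.IsBoundary F) a b

/-- `⟨a, b⟩_{∂Ω}`. -/
def facePairBdry (T : Mesh d Ω) (a b : T.Cell → T.Face → E d → ℝ) : ℝ :=
  T.facePairOn T.IsBoundary a b

/-- The normal trace `v · n` on `∂𝒯_h` of a vector function given element by element. -/
def normalTrace (T : Mesh d Ω) (v : T.Cell → E d → E d) : T.Cell → T.Face → E d → ℝ :=
  fun K F x => inner ℝ (v K x) (T.normal K F)

/-- The normal component `ν · n` on `∂𝒯_h` of a (single-valued) vector function on the faces. -/
def normalComp (T : Mesh d Ω) (ν : ∀ F : T.Face, Lp (E d) 2 (T.faceMeasure F)) :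
    T.Cell → T.Face → E d → ℝ :=
  fun K F x => inner ℝ (ν F x) (T.normal K F)

/-- The trace on `∂𝒯_h` of a scalar function given element by element. -/
def trace (T : Mesh d Ω) (w : T.Cell → E d → ℝ) : T.Cell → T.Face → E d → ℝ :=
  fun K _ x => w K x

/-- A single-valued scalar function on the faces, seen on `∂𝒯_h`. -/
def single (T : Mesh d Ω) (μ : ∀ F, T.L2 F) : T.Cell → T.Face → E d → ℝ :=
  fun _ F x => μ F x

end Mesh

/-- The element-by-element gradient. -/
def grad {ι : Type} (w : ι → E d → ℝ) : ι → E d → E d := fun K x => gradient (w K) x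

/-- The element-by-element divergence. -/
def dvg {ι : Type} (v : ι → E d → E d) : ι → E d → ℝ :=
  fun K x => ∑ i : Fin d, fderiv ℝ (v K) x (EuclideanSpace.single i 1) i

/-! ### Finite element spaces -/

/-- Local spaces `V(K)`, `W(K)`, `M(F)`. Elements of `V(K)` and `W(K)` are given by functions that
are `C¹` near `K`; only their values on `K` matter. -/
structure LocalSpaces (T : Mesh d Ω) where
  V : T.Cell → Submodule ℝ (E d → E d)
  W : T.Cell → Submodule ℝ (E d → ℝ)
  M : ∀ F : T.Face, Submodule ℝ (T.L2 F)
  V_contDiffAt : ∀ K, ∀ v ∈ V K, ∀ x ∈ T.cell K, ContDiffAt ℝ 1 v x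
  W_contDiffAt : ∀ K, ∀ w ∈ W K, ∀ x ∈ T.cell K, ContDiffAt ℝ 1 w x
  M_finite : ∀ F, FiniteDimensional ℝ (M F)

attribute [instance] LocalSpaces.M_finite

namespace LocalSpaces

variable {T : Mesh d Ω} (S : LocalSpaces T)

/-- `V_h` -/
def Vh : Set (T.Cell → E d → E d) := {v | ∀ K, v K ∈ S.V K}

/-- `W_h` -/
def Wh : Set (T.Cell → E d → ℝ) := {w | ∀ K, w K ∈ S.W K}

/-- `M_h` -/
def Mh : Set (∀ F, T.L2 F) := {μ | ∀ F, μ F ∈ S.M F}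

/-- `N_h = {ν ∈ L²(ℱ_h)^d : ν · n|_F ∈ M(F) for all faces F}` -/
def Nh : Set (∀ F : T.Face, Lp (E d) 2 (T.faceMeasure F)) :=
  {ν | ∀ K, ∀ F ∈ T.facesOf K, T.toL2 F (T.normalComp ν K F) ∈ S.M F}

/-- The `L²(F)`-orthogonal projection `P_{M(F)}`. -/
def PM (F : T.Face) : T.L2 F →ₗ[ℝ] T.L2 F := ((S.M F).starProjection).toLinearMap

/-- `V(K) · n|_F ⊆ M(F)` for every face `F` of every element `K`. -/
def NormalTracesIn : Prop :=
  ∀ K, ∀ F ∈ T.facesOf K, ∀ v ∈ S.V K,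
    T.toL2 F (fun x => inner ℝ (v x) (T.normal K F)) ∈ S.M F

/-! ### The HDG method -/

/-- A stabilization function: on each face `F` of each element `K`, a linear operator on `L²(F)`. -/
abbrev Stab (T : Mesh d Ω) : Type := ∀ (_ : T.Cell) (F : T.Face), T.L2 F →ₗ[ℝ] T.L2 F

/-- The Lehrenfeld–Schöberl stabilization `τ = (ρ / h_K) P_{M(F)}`. -/
def lsStab (ρ : ℝ) : Stab T := fun K F => (ρ / T.h K) • S.PM F

/-- The normal component of the numerical flux,
`q̂_h · n = q_h · n + τ (u_h - û_h)` on `∂𝒯_h`, as an element of `L²(F)` for each side of `F`. -/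
def _root_.HDG.numFlux (T : Mesh d Ω) (τ : Stab T) (q : T.Cell → E d → E d) (u : T.Cell → E d → ℝ)
    (uhat : ∀ F, T.L2 F) (K : T.Cell) (F : T.Face) : T.L2 F :=
  T.toL2 F (T.normalTrace q K F) + τ K F (T.toL2 F (u K) - uhat F)

/-- `(q_h, u_h, û_h) ∈ V_h × W_h × M_h` is a solution of the HDG method with stabilization `τ`. -/
structure IsHDGSolution (τ : Stab T) (c : E d → E d →L[ℝ] E d) (f uD : E d → ℝ)
    (q : T.Cell → E d → E d) (u : T.Cell → E d → ℝ) (uhat : ∀ F, T.L2 F) : Prop where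
  q_mem : q ∈ S.Vh
  u_mem : u ∈ S.Wh
  uhat_mem : uhat ∈ S.Mh
  eq_q : ∀ v ∈ S.Vh,
    T.volPairVec (fun K x => c x (q K x)) v - T.volPair u (dvg v)
      + T.facePair (T.single uhat) (T.normalTrace v) = 0
  eq_u : ∀ w ∈ S.Wh,
    - T.volPairVec q (grad w) + T.facePair (fun K F => numFlux T τ q u uhat K F) (T.trace w)
      = T.volPair (fun _ => f) w
  eq_transmission : ∀ μ ∈ S.Mh,
    T.facePairInt (T.single μ) (fun K F => numFlux T τ q u uhat K F) = 0
  eq_boundary : ∀ μ ∈ S.Mh,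
    T.facePairBdry (T.single μ) (T.single uhat) = T.facePairBdry (T.single μ) (fun _ _ => uD)

/-- The single-valued vector function `q̂_h` on the faces has as normal component, on both sides of
each face, the numerical flux of the HDG method. -/
def _root_.HDG.IsNumFlux (T : Mesh d Ω) (τ : Stab T) (q : T.Cell → E d → E d)
    (u : T.Cell → E d → ℝ) (uhat : ∀ F, T.L2 F)
    (qhat : ∀ F : T.Face, Lp (E d) 2 (T.faceMeasure F)) : Prop :=
  ∀ K, ∀ F ∈ T.facesOf K, T.toL2 F (T.normalComp qhat K F) = numFlux T τ q u uhat K F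

/-! ### The rewriting in terms of `(q_h, u_h, q̂_h)` -/

/-- `P_M u_h + (h / ρ) (q_h - q̂_h) · n` on `∂𝒯_h`. -/
def elimTrace (ρ : ℝ) (q : T.Cell → E d → E d) (u : T.Cell → E d → ℝ)
    (qhat : ∀ F : T.Face, Lp (E d) 2 (T.faceMeasure F)) (K : T.Cell) (F : T.Face) : T.L2 F :=
  S.PM F (T.toL2 F (u K)) + (T.h K / ρ) •
    T.toL2 F (fun x => inner ℝ (q K x - qhat F x) (T.normal K F))

/-- The system obtained by replacing `û_h` by `P_M u_h + (h / ρ) (q_h - q̂_h) · n` on `∂𝒯_h`. -/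
structure IsRewrittenSolution (ρ : ℝ) (c : E d → E d →L[ℝ] E d) (f uD : E d → ℝ)
    (q : T.Cell → E d → E d) (u : T.Cell → E d → ℝ)
    (qhat : ∀ F : T.Face, Lp (E d) 2 (T.faceMeasure F)) : Prop where
  q_mem : q ∈ S.Vh
  u_mem : u ∈ S.Wh
  qhat_mem : qhat ∈ S.Nh
  eq_q : ∀ v ∈ S.Vh,
    T.volPairVec (fun K x => c x (q K x)) v - T.volPair u (dvg v)
      + T.facePair (fun K F => S.elimTrace ρ q u qhat K F) (T.normalTrace v) = 0
  eq_u : ∀ w ∈ S.Wh,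
    - T.volPairVec q (grad w) + T.facePair (T.normalComp qhat) (T.trace w)
      = T.volPair (fun _ => f) w
  eq_transmission : ∀ ν ∈ S.Nh,
    T.facePair (fun K F => S.elimTrace ρ q u qhat K F) (T.normalComp ν)
      = T.facePairBdry (fun _ _ => uD) (T.normalComp ν)

/-- `⟨(h / ρ) (q - q̂) · n, (v - ν) · n⟩_{∂𝒯_h}`. -/
def _root_.HDG.stabForm (T : Mesh d Ω) (ρ : ℝ)
    (q : T.Cell → E d → E d) (qhat : ∀ F : T.Face, Lp (E d) 2 (T.faceMeasure F))
    (v : T.Cell → E d → E d) (ν : ∀ F : T.Face, Lp (E d) 2 (T.faceMeasure F)) : ℝ :=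
  T.facePair (fun K F x => T.h K / ρ * inner ℝ (q K x - qhat F x) (T.normal K F))
    (fun K F x => inner ℝ (v K x - ν F x) (T.normal K F))

/-- The final form of the rewritten system: two equations for `(q_h, u_h, q̂_h)`. -/
structure IsFinalSolution (ρ : ℝ) (c : E d → E d →L[ℝ] E d) (f uD : E d → ℝ)
    (q : T.Cell → E d → E d) (u : T.Cell → E d → ℝ)
    (qhat : ∀ F : T.Face, Lp (E d) 2 (T.faceMeasure F)) : Prop where
  q_mem : q ∈ S.Vh
  u_mem : u ∈ S.Wh
  qhat_mem : qhat ∈ S.Nh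
  eq_q : ∀ v ∈ S.Vh, ∀ ν ∈ S.Nh,
    (T.volPairVec (fun K x => c x (q K x)) v + stabForm T ρ q qhat v ν)
      - (- T.volPairVec (grad u) v + T.facePair (T.trace u) (T.normalComp ν))
      = - T.facePairBdry (fun _ _ => uD) (T.normalComp ν)
  eq_u : ∀ w ∈ S.Wh,
    - T.volPairVec q (grad w) + T.facePair (T.normalComp qhat) (T.trace w)
      = T.volPair (fun _ => f) w

end LocalSpaces

/-! ### Polynomial spaces -/

/-- `𝒫_k`: polynomial functions on `ℝ^d` of total degree at most `k`. -/
def polySpace (d k : ℕ) : Submodule ℝ (E d → ℝ) :=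
  (MvPolynomial.restrictTotalDegree (Fin d) ℝ k).map
    (MvPolynomial.aeval (R := ℝ) (fun (i : Fin d) (x : E d) => x i)).toLinearMap

/-- `[𝒫_k]^d`. -/
def polyVecSpace (d k : ℕ) : Submodule ℝ (E d → E d) where
  carrier := {v | ∀ i, (fun x => v x i) ∈ polySpace d k}
  add_mem' := fun ha hb i => (polySpace d k).add_mem (ha i) (hb i)
  zero_mem' := fun _ => (polySpace d k).zero_mem
  smul_mem' := fun r _ ha i => (polySpace d k).smul_mem r (ha i)

/-- `𝒫_k(F)` as a subspace of `L²(F)`: classes of restrictions to `F` of polynomials of degree at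
most `k`. -/
def polyFaceSpace (T : Mesh d Ω) (k : ℕ) (F : T.Face) : Submodule ℝ (T.L2 F) where
  carrier := {g | ∃ p ∈ polySpace d k, (g : E d → ℝ) =ᵐ[T.faceMeasure F] p}
  add_mem' := by
    rintro a b ⟨p, hp, hap⟩ ⟨r, hr, hbr⟩
    exact ⟨p + r, (polySpace d k).add_mem hp hr, (Lp.coeFn_add a b).trans (hap.add hbr)⟩
  zero_mem' := ⟨0, (polySpace d k).zero_mem, Lp.coeFn_zero ℝ 2 (T.faceMeasure F)⟩
  smul_mem' := by
    rintro s a ⟨p, hp, hap⟩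
    exact ⟨s • p, (polySpace d k).smul_mem s hp,
      (Lp.coeFn_smul s a).trans (hap.const_smul s)⟩

theorem polySpace_contDiff {k : ℕ} {p : E d → ℝ} (hp : p ∈ polySpace d k) :
    ContDiff ℝ 1 p := by
  obtain ⟨P, -, rfl⟩ := hp
  induction P using MvPolynomial.induction_on with
  | C a =>
    simp only [AlgHom.toLinearMap_apply, MvPolynomial.aeval_C]
    exact contDiff_const
  | add p q hp hq =>
    simp only [AlgHom.toLinearMap_apply, map_add] at hp hq ⊢
    exact hp.add hq
  | mul_X p i hp =>
    simp only [AlgHom.toLinearMap_apply, map_mul, MvPolynomial.aeval_X] at hp ⊢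
    exact hp.mul (by fun_prop)

theorem polyVecSpace_contDiff {k : ℕ} {v : E d → E d} (hv : v ∈ polyVecSpace d k) :
    ContDiff ℝ 1 v :=
  (contDiff_euclidean).2 fun i => polySpace_contDiff (hv i)

theorem polySpace_finite (d k : ℕ) : FiniteDimensional ℝ (polySpace d k) := by
  have : Module.Finite ℝ (MvPolynomial.restrictTotalDegree (Fin d) ℝ k) := by
    infer_instance
  unfold polySpace
  infer_instance

theorem polyFaceSpace_finite (T : Mesh d Ω) (k : ℕ) (F : T.Face) :
    FiniteDimensional ℝ (polyFaceSpace T k F) := by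
  have := polySpace_finite d k
  have hm : ∀ p : polySpace d k, AEStronglyMeasurable (p : E d → ℝ) (T.faceMeasure F) :=
    fun p => (polySpace_contDiff p.2).continuous.aestronglyMeasurable
  let φ : polySpace d k →ₗ[ℝ] (E d →ₘ[T.faceMeasure F] ℝ) :=
    { toFun := fun p => AEEqFun.mk p (hm p)
      map_add' := fun _ _ => rfl
      map_smul' := fun _ _ => rfl }
  let ψ : polyFaceSpace T k F →ₗ[ℝ] LinearMap.range φ :=
    { toFun := fun g => ⟨((g : T.L2 F) : E d →ₘ[T.faceMeasure F] ℝ), by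
        obtain ⟨p, hp, hgp⟩ := g.2
        exact ⟨⟨p, hp⟩, AEEqFun.ext ((AEEqFun.coeFn_mk p (hm ⟨p, hp⟩)).trans hgp.symm)⟩⟩
      map_add' := fun _ _ => rfl
      map_smul' := fun _ _ => rfl }
  refine Module.Finite.of_injective ψ fun a b hab => ?_
  have hab2 : (ψ a : E d →ₘ[T.faceMeasure F] ℝ) = ψ b := congrArg Subtype.val hab
  exact Subtype.ext (Subtype.ext hab2)

/-- The choice `V(K) = [𝒫_k(K)]^d`, `W(K) = 𝒫_{k+1}(K)`, `M(F) = 𝒫_k(F)`. -/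
def polySpaces (T : Mesh d Ω) (k : ℕ) : LocalSpaces T where
  V := fun _ => polyVecSpace d k
  W := fun _ => polySpace d (k + 1)
  M := polyFaceSpace T k
  V_contDiffAt := fun _ _ hv _ _ => (polyVecSpace_contDiff hv).contDiffAt
  W_contDiffAt := fun _ _ hw _ _ => (polySpace_contDiff hw).contDiffAt
  M_finite := polyFaceSpace_finite T k

/-! ### The 2014 weak Galerkin mixed method -/

/-- `D ∈ 𝒫_{k+1}(K)` is the discrete weak divergence on `K` of the weak vector function
`{v_0, v_b}`: `(D, φ)_K = -(v_0, ∇φ)_K + ⟨v_b · n, φ⟩_{∂K}` for all `φ ∈ 𝒫_{k+1}(K)`. -/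
def IsWeakDiv (T : Mesh d Ω) (k : ℕ) (K : T.Cell) (v₀ : E d → E d)
    (vb : ∀ F : T.Face, Lp (E d) 2 (T.faceMeasure F)) (D : E d → ℝ) : Prop :=
  D ∈ polySpace d (k + 1) ∧ ∀ φ ∈ polySpace d (k + 1),
    ∫ x in T.cell K, D x * φ x =
      - (∫ x in T.cell K, inner ℝ (v₀ x) (gradient φ x))
        + ∑ F ∈ T.facesOf K, ∫ x, T.normalComp vb K F x * φ x ∂(T.faceMeasure F)

open Classical in
/-- The discrete weak divergence `∇_w · {v_0, v_b}`, element by element. -/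
def weakDiv (T : Mesh d Ω) (k : ℕ) (v₀ : T.Cell → E d → E d)
    (vb : ∀ F : T.Face, Lp (E d) 2 (T.faceMeasure F)) : T.Cell → E d → ℝ :=
  fun K => if hD : ∃ D, IsWeakDiv T k K (v₀ K) vb D then hD.choose else 0

/-- The Wang–Ye mixed weak Galerkin scheme of degree `k`, with stabilization coefficient `h_K / ρ`:
find `q_h = {q_0, q_b}` with `q_0|_K ∈ [𝒫_k(K)]^d`, `q_b · n|_F ∈ 𝒫_k(F)`, and `u_h` with
`u_h|_K ∈ 𝒫_{k+1}(K)`, such that `a_s(q_h, v) - (∇_w · v, u_h) = -⟨u_D, v_b · n⟩_{∂Ω}` and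
`(∇_w · q_h, w) = (f, w)`, where
`a_s(q_h, v) = (c q_0, v_0) + ∑_K (h_K / ρ) ⟨(q_0 - q_b) · n, (v_0 - v_b) · n⟩_{∂K}`. -/
structure IsWGSolution (T : Mesh d Ω) (k : ℕ) (ρ : ℝ) (c : E d → E d →L[ℝ] E d)
    (f uD : E d → ℝ) (q₀ : T.Cell → E d → E d)
    (qb : ∀ F : T.Face, Lp (E d) 2 (T.faceMeasure F)) (u : T.Cell → E d → ℝ) : Prop where
  q₀_mem : ∀ K, q₀ K ∈ polyVecSpace d k
  qb_mem : ∀ K, ∀ F ∈ T.facesOf K, T.toL2 F (T.normalComp qb K F) ∈ polyFaceSpace T k F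
  u_mem : ∀ K, u K ∈ polySpace d (k + 1)
  eq_q : ∀ (v₀ : T.Cell → E d → E d) (vb : ∀ F : T.Face, Lp (E d) 2 (T.faceMeasure F)),
    (∀ K, v₀ K ∈ polyVecSpace d k) →
    (∀ K, ∀ F ∈ T.facesOf K, T.toL2 F (T.normalComp vb K F) ∈ polyFaceSpace T k F) →
    (T.volPairVec (fun K x => c x (q₀ K x)) v₀ + stabForm T ρ q₀ qb v₀ vb)
      - T.volPair (weakDiv T k v₀ vb) u
      = - T.facePairBdry (fun _ _ => uD) (T.normalComp vb)
  eq_u : ∀ w : T.Cell → E d → ℝ, (∀ K, w K ∈ polySpace d (k + 1)) →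
    T.volPair (weakDiv T k q₀ qb) w = T.volPair (fun _ => f) w

end HDG

end

open MeasureTheory Set
open scoped ENNReal

noncomputable section

namespace HDG

/-! On each face, part (A) is linear algebra in the finite-dimensional space `M(F)`. The assumption
on normal traces puts `q_h · n`, hence also the numerical flux, in `M(F)`; moreover `P_M û_h = û_h`.
So the flux relation reads `q̂_h · n = q_h · n + (ρ/h)(P_M u_h - û_h)`, and since `ρ/h` is positive
it can be solved for `û_h` (`isNumFlux_iff`).

The HDG method and the rewritten system then differ in which unknown is single-valued by definition
and which by an equation: `û_h` is built in and the flux imposed in the first, the reverse holds in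
the second. In both cases the imposed property follows by testing with the mismatch itself on a
single face, which is admissible because it lies in `M(F)` (`numFlux_add_numFlux_eq_zero`,
`IsRewrittenSolution.elimTrace_eq_someCell`). Conversely, outward normals on the two sides of an
interior face are opposite (`normal_eq_neg`), so a single-valued scalar times the normal component
of a single-valued vector sums to zero there (`facePairInt_single_normalComp`). On boundary faces
`normalLift` and `someNormalComp` exchange scalar test functions and normal components, so the
boundary conditions agree.

For the two-equation form, the third equation is subtracted from the first, `P_M` disappears because
it is tested against elements of `M(F)`, and `(u_h, ∇ · v)` is integrated by parts (`final_lhs_eq`).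
The two equations are recovered by taking `ν = 0` first.

The analytic core is this integration by parts on a non-convex element of which only a flat-face
description of the boundary is known. Slice the element by lines parallel to a coordinate axis.
Almost every line misses the relative boundaries of the faces and all faces parallel to the axis, so
it meets the element in a bounded set with finitely many transversal end points; the fundamental
theorem of calculus applies to it (`setIntegral_deriv_of_local_halfLine`). Integrating over the
lines and projecting each face along the axis, with Jacobian `|n i|`, gives the surface integrals of
`φ (n i)`.

In part (B), the `L²(K)` form on polynomials is nondegenerate, since a polynomial vanishing on an
open set is zero. This gives existence and uniqueness of the weak divergence, and its defining
identity turns one scheme into the other. -/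

/-! ### One-dimensional step -/

/-- The fundamental theorem of calculus on a bounded set `S ⊆ ℝ` whose boundary consists of finitely
many points `t j`, near which `S` is the half-line `σ j * (r - t j) ≤ 0`. -/
theorem setIntegral_deriv_of_local_halfLine {ι : Type*} (s : Finset ι) (t σ : ι → ℝ) (S : Set ℝ)
    (hσ : ∀ j ∈ s, σ j ≠ 0) (hinj : Set.InjOn t s)
    (hloc : ∀ j ∈ s, ∀ᶠ r in nhds (t j), (r ∈ S ↔ σ j * (r - t j) ≤ 0))
    (hreg : ∀ r, (∀ j ∈ s, r ≠ t j) →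
      (∀ᶠ r' in nhds r, r' ∈ S) ∨ ∀ᶠ r' in nhds r, r' ∉ S)
    (hb : Bornology.IsBounded S) (hm : MeasurableSet S)
    {g : ℝ → ℝ} (hg : ContDiff ℝ 1 g) (hgc : HasCompactSupport g) :
    ∫ r in S, deriv g r = ∑ j ∈ s, (SignType.sign (σ j) : ℝ) * g (t j) := by
  classical
  -- Each end point contributes a jump function vanishing to its right: `1` on `r ≤ t j` for a right
  -- end, `-1` on `r < t j` for a left end. The strict inequality in the second case makes the
  -- indicator of `S` minus this jump constant near `t j`, including at `t j` itself.
  let step : ι → ℝ → ℝ := fun j r =>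
    if 0 < σ j then (if r ≤ t j then 1 else 0) else (if r < t j then -1 else 0)
  let D : ℝ → ℝ := fun r => S.indicator 1 r - ∑ j ∈ s, step j r
  have hstep : ∀ j r, r ≠ t j → ∀ᶠ r' in nhds r, step j r' = step j r := by
    intro j r hr
    rcases lt_or_gt_of_ne hr with h | h
    · filter_upwards [eventually_lt_nhds h] with r' hr'
      simp [step, hr', hr'.le, h, h.le]
    · filter_upwards [eventually_gt_nhds h] with r' hr'
      simp [step, not_le.2 hr', not_lt.2 hr'.le, not_le.2 h, not_lt.2 h.le]
  have hsum : ∀ (s' : Finset ι) r, (∀ j ∈ s', r ≠ t j) →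
      ∀ᶠ r' in nhds r, ∑ j ∈ s', step j r' = ∑ j ∈ s', step j r := by
    intro s' r h
    have : ∀ᶠ r' in nhds r, ∀ j ∈ s', step j r' = step j r :=
      (Filter.eventually_all_finset s').2 fun j hj => hstep j r (h j hj)
    filter_upwards [this] with r' hr' using Finset.sum_congr rfl hr'
  have hD : IsLocallyConstant D := by
    rw [IsLocallyConstant.iff_eventually_eq]
    intro r
    by_cases hr : ∀ j ∈ s, r ≠ t j
    · have hS : ∀ᶠ r' in nhds r, S.indicator (1 : ℝ → ℝ) r' = S.indicator 1 r := by
        rcases hreg r hr with h | h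
        · filter_upwards [h] with r' hr'
          simp [hr', h.self_of_nhds]
        · filter_upwards [h] with r' hr'
          simp [hr', h.self_of_nhds]
      filter_upwards [hsum s r hr, hS] with r' h1 h2
      simp only [D, h1, h2]
    · push Not at hr
      obtain ⟨j, hj, rfl⟩ := hr
      have hne : ∀ k ∈ s.erase j, t j ≠ t k := by
        intro k hk h
        exact (Finset.ne_of_mem_erase hk) (hinj (Finset.mem_of_mem_erase hk) hj h.symm)
      have key : ∀ r, (r ∈ S ↔ σ j * (r - t j) ≤ 0) →
          S.indicator (1 : ℝ → ℝ) r - step j r = if 0 < σ j then 0 else 1 := by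
        intro r hr
        by_cases hp : 0 < σ j
        · have : r ∈ S ↔ r ≤ t j := by
            rw [hr]
            constructor
            · intro h; nlinarith
            · intro h; nlinarith
          by_cases h : r ≤ t j <;> simp [indicator, step, hp, this, h]
        · have hn : σ j < 0 := lt_of_le_of_ne (not_lt.1 hp) (hσ j hj)
          have : r ∈ S ↔ ¬ r < t j := by
            rw [hr, not_lt]
            constructor
            · intro h; nlinarith
            · intro h; nlinarith
          by_cases h : r < t j <;> simp [indicator, step, hp, this, h]
      filter_upwards [hsum _ _ hne, hloc j hj] with r' h1 h2
      have e : ∀ r, D r = (S.indicator (1 : ℝ → ℝ) r - step j r) - ∑ k ∈ s.erase j, step k r := by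
        intro r
        simp only [D]
        rw [← Finset.add_sum_erase s _ hj]
        ring
      rw [e, e, key r' h2, key _ (hloc j hj).self_of_nhds, h1]
  -- A locally constant function on the connected line is constant, and `D` vanishes far to the
  -- right because `S` is bounded and all the jump functions are zero there.
  have hD0 : ∀ r, D r = 0 := by
    obtain ⟨R, hR⟩ := hb.subset_closedBall 0
    have hfin : ∃ r, r ∉ S ∧ ∀ j ∈ s, t j < r := by
      have h1 : ∀ᶠ r : ℝ in Filter.atTop, ∀ j ∈ s, t j < r :=
        (Filter.eventually_all_finset s).2 fun j _ => Filter.eventually_gt_atTop _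
      obtain ⟨r, hr1, hr2⟩ := (h1.and (Filter.eventually_gt_atTop R)).exists
      refine ⟨r, fun h => ?_, hr1⟩
      have := hR h
      rw [Metric.mem_closedBall, Real.dist_eq, sub_zero] at this
      exact absurd (le_trans (le_abs_self r) this) (not_le.2 hr2)
    obtain ⟨r₀, h1, h2⟩ := hfin
    intro r
    rw [hD.apply_eq_of_preconnectedSpace r r₀]
    simp only [D, indicator_of_notMem h1, zero_sub, neg_eq_zero]
    refine Finset.sum_eq_zero fun j hj => ?_
    simp [step, not_le.2 (h2 j hj), not_lt.2 (h2 j hj).le]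
  have hdc : HasCompactSupport (deriv g) := hgc.deriv
  have hdi : Integrable (deriv g) :=
    (hg.continuous_deriv le_rfl).integrable_of_hasCompactSupport hdc
  have hpt : ∀ r, S.indicator (deriv g) r = ∑ j ∈ s, step j r * deriv g r := by
    intro r
    have h := hD0 r
    simp only [D, sub_eq_zero] at h
    rw [← Finset.sum_mul, ← h]
    by_cases hr : r ∈ S <;> simp [hr]
  have hterm : ∀ j ∈ s, (Integrable fun r => step j r * deriv g r) ∧
      ∫ r, step j r * deriv g r = (SignType.sign (σ j) : ℝ) * g (t j) := by
    intro j hj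
    by_cases hp : 0 < σ j
    · have e : (fun r => step j r * deriv g r) = (Iic (t j)).indicator (deriv g) := by
        ext r
        by_cases h : r ≤ t j <;> simp [step, hp, h]
      rw [e]
      refine ⟨hdi.indicator measurableSet_Iic, ?_⟩
      rw [integral_indicator measurableSet_Iic, hgc.integral_Iic_deriv_eq hg, sign_pos hp]
      simp
    · have hn : σ j < 0 := lt_of_le_of_ne (not_lt.1 hp) (hσ j hj)
      have e : (fun r => step j r * deriv g r) = fun r => -((Iio (t j)).indicator (deriv g) r) := by
        ext r
        by_cases h : r < t j <;> simp [step, hp, h]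
      rw [e]
      refine ⟨(hdi.indicator measurableSet_Iio).neg, ?_⟩
      rw [integral_neg, integral_indicator measurableSet_Iio, ← integral_Iic_eq_integral_Iio,
        hgc.integral_Iic_deriv_eq hg, sign_neg hn]
      simp
  rw [← integral_indicator hm]
  simp_rw [hpt]
  rw [integral_finsetSum _ fun j hj => (hterm j hj).1]
  exact Finset.sum_congr rfl fun j hj => (hterm j hj).2

/-! ### Splitting off one coordinate -/

/-- Forget the `i`-th coordinate. -/
def dropCoord {m : ℕ} (i : Fin (m + 1)) (x : E (m + 1)) : Fin m → ℝ := fun j => x (i.succAbove j)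

/-- The point with `i`-th coordinate `t` and other coordinates `y`. -/
def insCoord {m : ℕ} (i : Fin (m + 1)) (y : Fin m → ℝ) (t : ℝ) : E (m + 1) :=
  WithLp.toLp 2 (i.insertNth t y)

section coords

variable {m : ℕ} (i : Fin (m + 1))

@[simp] theorem insCoord_same (y : Fin m → ℝ) (t : ℝ) : insCoord i y t i = t := by
  simp [insCoord]

@[simp] theorem insCoord_succAbove (y : Fin m → ℝ) (t : ℝ) (j : Fin m) :
    insCoord i y t (i.succAbove j) = y j := by
  simp [insCoord]

@[simp] theorem dropCoord_insCoord (y : Fin m → ℝ) (t : ℝ) : dropCoord i (insCoord i y t) = y := by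
  ext j; simp [dropCoord]

theorem insCoord_dropCoord (x : E (m + 1)) : insCoord i (dropCoord i x) (x i) = x := by
  ext j
  refine Fin.succAboveCases i ?_ (fun k => ?_) j
  · simp
  · simp [dropCoord]

theorem insCoord_eq (y : Fin m → ℝ) (t : ℝ) :
    insCoord i y t = insCoord i y 0 + t • EuclideanSpace.single i (1 : ℝ) := by
  ext j
  refine Fin.succAboveCases i ?_ (fun k => ?_) j
  · simp
  · simp [Fin.succAbove_ne i k]

theorem continuous_insCoord : Continuous fun p : (Fin m → ℝ) × ℝ => insCoord i p.1 p.2 := by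
  unfold insCoord
  fun_prop

theorem continuous_dropCoord : Continuous (dropCoord i) := by
  unfold dropCoord
  fun_prop

theorem lipschitzWith_dropCoord : LipschitzWith 1 (dropCoord i) := by
  refine LipschitzWith.of_dist_le_mul fun x y => ?_
  rw [NNReal.coe_one, one_mul, dist_pi_le_iff dist_nonneg]
  intro j
  rw [dist_eq_norm, dist_eq_norm]
  exact PiLp.norm_apply_le (x - y) (i.succAbove j)

/-- A 1-Lipschitz map does not increase Hausdorff measure, Lebesgue measure on `Fin m → ℝ` with the
sup metric is the `m`-dimensional Hausdorff measure, and the Euclidean normalization is a positive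
factor. -/
theorem volume_dropCoord_image_eq_zero {B : Set (E (m + 1))}
    (hB : (Measure.euclideanHausdorffMeasure m : Measure (E (m + 1))) B = 0) :
    volume (dropCoord i '' B) = 0 := by
  rw [Measure.euclideanHausdorffMeasure_def, Measure.smul_apply, ENNReal.smul_def, smul_eq_mul,
    mul_eq_zero] at hB
  have h0 : (Measure.hausdorffMeasure (m : ℝ) : Measure (E (m + 1))) B = 0 := by
    rcases hB with h | h
    · exact absurd h (by simpa using (Measure.addHaarScalarFactor_pos_of_isAddHaarMeasure _ _).ne')
    · exact h
  have h1 := (lipschitzWith_dropCoord i).hausdorffMeasure_image_le (d := (m : ℝ))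
    (by positivity) B
  rw [h0, mul_zero] at h1
  have h2 : (Measure.hausdorffMeasure (m : ℝ) : Measure (Fin m → ℝ)) = volume := by
    simpa using hausdorffMeasure_pi_real (ι := Fin m)
  rw [← h2]
  exact le_antisymm h1 zero_le

theorem measurePreserving_insCoord :
    MeasurePreserving (fun p : (Fin m → ℝ) × ℝ => insCoord i p.1 p.2) := by
  have h1 := (volume_preserving_piFinSuccAbove (fun _ : Fin (m + 1) => ℝ) i).symm
  have h2 : MeasurePreserving (Prod.swap : (Fin m → ℝ) × ℝ → ℝ × (Fin m → ℝ)) volume volume :=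
    Measure.measurePreserving_swap
  exact (PiLp.volume_preserving_toLp (Fin (m + 1))).comp (h1.comp h2)

theorem integral_eq_integral_insCoord {f : E (m + 1) → ℝ} (hf : Integrable f) :
    ∫ x, f x = ∫ y : Fin m → ℝ, ∫ t, f (insCoord i y t) := by
  have h := measurePreserving_insCoord i
  have hf' : Integrable (fun p : (Fin m → ℝ) × ℝ => f (insCoord i p.1 p.2)) :=
    h.integrable_comp_of_integrable hf
  rw [← integral_prod _ hf', ← h.map_eq, integral_map h.aemeasurable]
  · rfl
  · rw [h.map_eq]; exact hf.aestronglyMeasurable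

end coords

/-! ### Projection of a subset of a hyperplane along a coordinate direction -/

section hyperplane

variable {m : ℕ} (i : Fin (m + 1))

theorem exists_orthonormalBasis_zero_eq {n : E (m + 1)} (hn : ‖n‖ = 1) :
    ∃ b : OrthonormalBasis (Fin (m + 1)) ℝ (E (m + 1)), b 0 = n := by
  obtain ⟨b, hb⟩ := Orthonormal.exists_orthonormalBasis_extension_of_card_eq (𝕜 := ℝ)
    (E := E (m + 1)) (ι := Fin (m + 1)) (by simp) (v := fun _ => n) (s := {0}) (by
      refine ⟨fun _ => hn, fun a b hab => ?_⟩
      exact absurd (Subsingleton.elim a b) hab)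
  exact ⟨b, hb 0 rfl⟩

/-- The minors of an orthogonal matrix along a column are, up to sign, the entries of the column. -/
theorem abs_det_minor (b : OrthonormalBasis (Fin (m + 1)) ℝ (E (m + 1))) :
    |(Matrix.of fun j k : Fin m => b k.succ (i.succAbove j)).det| = |b 0 i| := by
  let Q : Matrix (Fin (m + 1)) (Fin (m + 1)) ℝ := Matrix.of fun j k => b k j
  have hQ : Q.transpose * Q = 1 := by
    ext j k
    rw [Matrix.mul_apply]
    have := orthonormal_iff_ite.1 b.orthonormal j k
    rw [Matrix.one_apply, ← this, PiLp.inner_apply]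
    exact Finset.sum_congr rfl fun l _ => by simp [Q, mul_comm]
  have hdet : Q.det * Q.det = 1 := by
    have := congrArg Matrix.det hQ
    rwa [Matrix.det_mul, Matrix.det_transpose, Matrix.det_one] at this
  have habs : |Q.det| = 1 := by
    rcases mul_self_eq_one_iff.1 hdet with h | h <;> simp [h]
  -- For an orthogonal matrix the inverse is the transpose, so cofactors equal entries up to the
  -- determinant, which is `±1`.
  have hadj : Q.adjugate = Q.det • Q.transpose := by
    calc Q.adjugate = (Q.transpose * Q) * Q.adjugate := by rw [hQ, one_mul]
      _ = Q.transpose * (Q * Q.adjugate) := by rw [mul_assoc]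
      _ = Q.det • Q.transpose := by rw [Matrix.mul_adjugate]; simp
  have h := Matrix.adjugate_fin_succ_eq_det_submatrix Q 0 i
  rw [hadj, Matrix.smul_apply, Matrix.transpose_apply, smul_eq_mul] at h
  have h2 := congrArg abs h
  rw [abs_mul, abs_mul, habs, one_mul, abs_pow, abs_neg, abs_one, one_pow, one_mul] at h2
  rw [show b 0 i = Q i 0 from rfl, h2]
  rfl

/-- Isometric parametrization of the hyperplane through `x₀` spanned by `b 1, …, b m`. -/
def hyperplaneChart (b : OrthonormalBasis (Fin (m + 1)) ℝ (E (m + 1))) (x₀ : E (m + 1)) (z : E m) :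
    E (m + 1) :=
  x₀ + b.repr.symm (WithLp.toLp 2 (Fin.cons 0 z.ofLp))

theorem isometry_hyperplaneChart (b : OrthonormalBasis (Fin (m + 1)) ℝ (E (m + 1)))
    (x₀ : E (m + 1)) : Isometry (hyperplaneChart b x₀) := by
  refine Isometry.of_dist_eq fun z w => ?_
  unfold hyperplaneChart
  rw [dist_add_left, LinearIsometryEquiv.dist_map, EuclideanSpace.dist_eq, EuclideanSpace.dist_eq,
    Fin.sum_univ_succ]
  simp

theorem mem_range_hyperplaneChart (b : OrthonormalBasis (Fin (m + 1)) ℝ (E (m + 1)))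
    (x₀ x : E (m + 1)) (hx : inner ℝ (b 0) (x - x₀) = 0) :
    x ∈ range (hyperplaneChart b x₀) := by
  refine ⟨WithLp.toLp 2 fun k => b.repr (x - x₀) k.succ, ?_⟩
  unfold hyperplaneChart
  have : (WithLp.toLp 2 (Fin.cons 0 fun k : Fin m => b.repr (x - x₀) k.succ) : E (m + 1))
      = b.repr (x - x₀) := by
    ext j
    refine Fin.cases ?_ (fun k => ?_) j
    · simpa [b.repr_apply_apply, inner_sub_right] using hx.symm
    · simp
  simp only [this, LinearIsometryEquiv.symm_apply_apply]
  abel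

/-- In the isometric chart the projection is affine, with linear part the minor computed in
`abs_det_minor`; this is the source of the Jacobian `|n i|`. -/
theorem dropCoord_hyperplaneChart (b : OrthonormalBasis (Fin (m + 1)) ℝ (E (m + 1)))
    (x₀ : E (m + 1)) (z : E m) :
    dropCoord i (hyperplaneChart b x₀ z) = dropCoord i x₀ +
      (Matrix.of fun j k : Fin m => b k.succ (i.succAbove j)).mulVec z.ofLp := by
  ext j
  simp only [dropCoord, hyperplaneChart, Pi.add_apply, PiLp.add_apply, Matrix.mulVec, dotProduct]
  congr 1
  rw [← b.sum_repr (b.repr.symm _), WithLp.ofLp_sum, Finset.sum_apply, Fin.sum_univ_succ]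
  simp [mul_comm]

variable {F : Set (E (m + 1))} {n x₀ : E (m + 1)}

/-- Change of variables for the projection of a subset of a hyperplane with unit normal `n` along
the `i`-th coordinate. -/
theorem setIntegral_dropCoord_image (hn : ‖n‖ = 1) (hF : ∀ x ∈ F, inner ℝ n (x - x₀) = 0)
    (hFm : MeasurableSet F) (hni : n i ≠ 0) {ψ : (Fin m → ℝ) → ℝ} (hψ : Continuous ψ) :
    ∫ y in dropCoord i '' F, ψ y =
      ∫ x, |n i| * ψ (dropCoord i x)
        ∂((Measure.euclideanHausdorffMeasure m : Measure (E (m + 1))).restrict F) := by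
  obtain ⟨b, rfl⟩ := exists_orthonormalBasis_zero_eq hn
  set A : Matrix (Fin m) (Fin m) ℝ := Matrix.of fun j k => b k.succ (i.succAbove j) with hA
  have hdet : |A.det| = |b 0 i| := abs_det_minor i b
  have hL := isometry_hyperplaneChart b x₀
  have hFr : F ⊆ range (hyperplaneChart b x₀) := fun x hx =>
    mem_range_hyperplaneChart b x₀ x (hF x hx)
  have h1 : (Measure.euclideanHausdorffMeasure m : Measure (E (m + 1))).restrict F
      = Measure.map (hyperplaneChart b x₀)
        (volume.restrict (hyperplaneChart b x₀ ⁻¹' F)) := by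
    rw [← Measure.restrict_map hL.continuous.measurable hFm,
      ← EuclideanSpace.euclideanHausdorffMeasure_eq_volume, hL.map_euclideanHausdorffMeasure,
      Measure.restrict_restrict hFm, inter_eq_left.2 hFr]
  have hc : Continuous fun x => |b 0 i| * ψ (dropCoord i x) :=
    continuous_const.mul (hψ.comp (continuous_dropCoord i))
  rw [h1, integral_map hL.continuous.aemeasurable hc.aestronglyMeasurable]
  have hpre : hyperplaneChart b x₀ ⁻¹' F = (WithLp.ofLp : E m → Fin m → ℝ) ⁻¹'
      ((fun z : Fin m → ℝ => hyperplaneChart b x₀ (WithLp.toLp 2 z)) ⁻¹' F) := by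
    ext z; simp
  set G : Set (Fin m → ℝ) := (fun z : Fin m → ℝ => hyperplaneChart b x₀ (WithLp.toLp 2 z)) ⁻¹' F
    with hG
  have hGm : MeasurableSet G := by
    refine MeasurableSet.preimage hFm (Continuous.measurable ?_)
    exact hL.continuous.comp (by fun_prop)
  have himg : dropCoord i '' F = (fun z => dropCoord i x₀ + Matrix.toLin' A z) '' G := by
    ext y
    constructor
    · rintro ⟨x, hx, rfl⟩
      obtain ⟨z, rfl⟩ := hFr hx
      refine ⟨z.ofLp, by simpa [hG] using hx, ?_⟩
      rw [dropCoord_hyperplaneChart]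
      simp [hA]
    · rintro ⟨z, hz, rfl⟩
      refine ⟨_, hz, ?_⟩
      rw [dropCoord_hyperplaneChart]
      simp [hA]
  -- The hyperplane is transversal to the axis exactly when `n i ≠ 0`; this gives the injectivity
  -- required by the change of variables.
  have hA0 : A.det ≠ 0 := by
    rw [← abs_ne_zero, hdet, abs_ne_zero]; exact hni
  have hinj : Function.Injective (Matrix.toLin' A) := by
    rw [Matrix.toLin'_apply']
    exact Matrix.mulVec_injective_iff_isUnit.2 ((Matrix.isUnit_iff_isUnit_det A).2 hA0.isUnit)
  rw [himg, integral_image_eq_integral_abs_det_fderiv_smul volume hGm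
    (f := fun z => dropCoord i x₀ + Matrix.toLin' A z) (f' := fun _ => LinearMap.toContinuousLinearMap (Matrix.toLin' A))
    (fun z _ => ((LinearMap.toContinuousLinearMap (Matrix.toLin' A)).hasFDerivAt.const_add
      _).hasFDerivWithinAt)
    (fun z _ w _ h => hinj (add_left_cancel h))]
  rw [hpre, (PiLp.volume_preserving_ofLp (Fin m)).setIntegral_preimage_emb
    (MeasurableEquiv.toLp 2 (Fin m → ℝ)).symm.measurableEmbedding
    (fun z => |b 0 i| * ψ (dropCoord i (hyperplaneChart b x₀ (WithLp.toLp 2 z)))) G]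
  refine setIntegral_congr_fun hGm fun z _ => ?_
  simp only [dropCoord_hyperplaneChart, smul_eq_mul, ← hdet, Matrix.toLin'_apply, ← hA]
  congr 2
  simp [LinearMap.det_toContinuousLinearMap]

/-- A subset of a hyperplane parallel to the `i`-th coordinate axis has negligible projection along
this axis. -/
theorem volume_dropCoord_image_of_parallel (hn : ‖n‖ = 1)
    (hF : ∀ x ∈ F, inner ℝ n (x - x₀) = 0) (hni : n i = 0) :
    volume (dropCoord i '' F) = 0 := by
  obtain ⟨b, rfl⟩ := exists_orthonormalBasis_zero_eq hn
  set A : Matrix (Fin m) (Fin m) ℝ := Matrix.of fun j k => b k.succ (i.succAbove j) with hA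
  have hdet : A.det = 0 := by
    rw [← abs_eq_zero, hA, abs_det_minor i b, hni, abs_zero]
  -- The projection lies in a translate of the range of a singular linear map, which is a null set.
  have himg : dropCoord i '' F ⊆ (fun y => dropCoord i x₀ + y) '' (Matrix.toLin' A '' univ) := by
    rintro _ ⟨x, hx, rfl⟩
    obtain ⟨z, rfl⟩ := mem_range_hyperplaneChart b x₀ x (hF x hx)
    refine ⟨_, ⟨z.ofLp, mem_univ _, rfl⟩, ?_⟩
    rw [dropCoord_hyperplaneChart]
    simp [hA]
  refine measure_mono_null himg ?_
  rw [image_add_left, measure_preimage_add, Measure.addHaar_image_linearMap, LinearMap.det_toLin',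
    hdet]
  simp

end hyperplane

/-! ### The divergence theorem on an element -/

theorem isometry_insCoord {m : ℕ} (i : Fin (m + 1)) (y : Fin m → ℝ) : Isometry (insCoord i y) := by
  refine Isometry.of_dist_eq fun t t' => ?_
  rw [insCoord_eq i y t, insCoord_eq i y t', dist_add_left, dist_eq_norm, ← sub_smul, norm_smul,
    PiLp.norm_single, norm_one, mul_one, Real.dist_eq, Real.norm_eq_abs]

theorem inner_insCoord {m : ℕ} (i : Fin (m + 1)) (n : E (m + 1)) (y : Fin m → ℝ) (t : ℝ) :
    inner ℝ n (insCoord i y t) = inner ℝ n (insCoord i y 0) + t * n i := by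
  rw [insCoord_eq i y t, inner_add_right, inner_smul_right, EuclideanSpace.inner_single_right]
  simp

theorem IsFlatFace.mem_intrinsicInterior_of_notMem {d : ℕ} {F : Set (E d)} {x : E d} (hx : x ∈ F)
    (h : x ∉ intrinsicFrontier ℝ F) : x ∈ intrinsicInterior ℝ F := by
  have : x ∈ intrinsicInterior ℝ F ∪ intrinsicFrontier ℝ F := by
    rw [intrinsicInterior_union_intrinsicFrontier]
    exact subset_intrinsicClosure hx
  exact this.resolve_right h

theorem IsFlatFace.nonempty_intrinsicInterior {d : ℕ} {F : Set (E d)} (hF : IsFlatFace F) :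
    (intrinsicInterior ℝ F).Nonempty := by
  rw [← closure_nonempty_iff, ← hF.eq_closure]
  exact hF.nonempty

variable {d : ℕ} {Ω : Set (E d)}

namespace Mesh

theorem face_subset_cell (T : Mesh d Ω) {K : T.Cell} {F : T.Face} (hF : F ∈ T.facesOf K) :
    T.face F ⊆ T.cell K := by
  intro x hx
  have : x ∈ frontier (T.cell K) := by
    rw [T.frontier_cell]
    exact mem_biUnion hF hx
  exact (T.cell_isCompact K).isClosed.frontier_subset this

theorem exists_mem_facesOf (T : Mesh d Ω) (F : T.Face) : ∃ K, F ∈ T.facesOf K := by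
  have h : {K | F ∈ T.facesOf K}.ncard ≠ 0 := by
    by_cases hF : T.face F ⊆ frontier Ω
    · rw [T.boundary_face F hF]; simp
    · rw [T.interior_face F hF]; simp
  exact nonempty_of_ncard_ne_zero h

/-- A face is the isometric image of a compact subset of `E m`, so its surface measure is the
Lebesgue measure of that set. -/
theorem isFiniteMeasure_faceMeasure_of_succ {m : ℕ} {Ω : Set (E (m + 1))} (T : Mesh (m + 1) Ω)
    (F : T.Face) : IsFiniteMeasure (T.faceMeasure F) := by
  obtain ⟨K, hK⟩ := T.exists_mem_facesOf F
  have hn := T.normal_spec K F hK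
  obtain ⟨x₀, hx₀⟩ := (T.face_isFlatFace F).nonempty
  obtain ⟨b, hb⟩ := exists_orthonormalBasis_zero_eq hn.norm_eq_one
  have hL := isometry_hyperplaneChart b x₀
  have hFr : T.face F ⊆ range (hyperplaneChart b x₀) := fun x hx =>
    mem_range_hyperplaneChart b x₀ x (by rw [hb]; exact hn.orthogonal x₀ hx₀ x hx)
  constructor
  rw [faceMeasure, Measure.restrict_apply_univ]
  have h := hL.euclideanHausdorffMeasure_preimage (d := m) (T.face F)
  rw [inter_eq_left.2 hFr, EuclideanSpace.euclideanHausdorffMeasure_eq_volume] at h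
  change (Measure.euclideanHausdorffMeasure m : Measure (E (m + 1))) (T.face F) < ∞
  rw [← h]
  exact (hL.isClosedEmbedding.isCompact_preimage (T.face_isFlatFace F).isCompact).measure_lt_top

instance isFiniteMeasure_faceMeasure (T : Mesh d Ω) (F : T.Face) :
    IsFiniteMeasure (T.faceMeasure F) := by
  rcases d with _ | m
  · exact absurd (T.face_isFlatFace F).finrank_direction (by simp)
  · exact T.isFiniteMeasure_faceMeasure_of_succ F

/-- Fubini reduces the volume integral to lines parallel to the `i`-th axis, where the
one-dimensional step gives signed values of `φ` at the crossed faces; the change of variables on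
each face turns the sign of `n i` into `n i`. -/
theorem setIntegral_partialDeriv_of_hasCompactSupport {m : ℕ} {Ω : Set (E (m + 1))}
    (T : Mesh (m + 1) Ω) (K : T.Cell) (i : Fin (m + 1)) {φ : E (m + 1) → ℝ} (hφ : ContDiff ℝ 1 φ)
    (hφc : HasCompactSupport φ) :
    ∫ x in T.cell K, fderiv ℝ φ x (EuclideanSpace.single i 1) =
      ∑ F ∈ T.facesOf K, ∫ x, φ x * T.normal K F i ∂(T.faceMeasure F) := by
  classical
  set N := T.normal K with hN
  have hspec := T.normal_spec K
  choose x₀ hx₀ using fun F => (T.face_isFlatFace F).nonempty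
  -- The parameter at which the line over `y` crosses the hyperplane of `F`. For a face parallel to
  -- the axis the value is meaningless, but such faces drop out below.
  let t : T.Face → (Fin m → ℝ) → ℝ := fun F y => inner ℝ (N F) (x₀ F - insCoord i y 0) / N F i
  have htc : ∀ F, Continuous (t F) := by
    intro F
    have : Continuous fun y : Fin m → ℝ => insCoord i y 0 :=
      (continuous_insCoord i).comp (continuous_id.prodMk continuous_const)
    exact (continuous_const.inner (continuous_const.sub this)).div_const _
  have hpt : ∀ F ∈ T.facesOf K, N F i ≠ 0 → ∀ x ∈ T.face F, t F (dropCoord i x) = x i := by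
    intro F hF hni x hx
    have h1 := (hspec F hF).orthogonal _ (hx₀ F) x hx
    rw [← insCoord_dropCoord i x, inner_sub_right, inner_insCoord] at h1
    simp only [t]
    rw [div_eq_iff hni, inner_sub_right]
    linarith
  have hins : ∀ F ∈ T.facesOf K, N F i ≠ 0 → ∀ y ∈ dropCoord i '' T.face F,
      insCoord i y (t F y) ∈ T.face F := by
    rintro F hF hni _ ⟨x, hx, rfl⟩
    rw [hpt F hF hni x hx, insCoord_dropCoord]
    exact hx
  -- Only a null set of lines meets the relative boundary of a face or a face parallel to the axis;
  -- all other lines cross faces transversally at relative interior points.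
  have hae : ∀ᵐ y : Fin m → ℝ, ∀ F ∈ T.facesOf K,
      y ∉ dropCoord i '' intrinsicFrontier ℝ (T.face F) ∧
        (N F i = 0 → y ∉ dropCoord i '' T.face F) := by
    refine (ae_ball_iff (T.facesOf K).countable_toSet).2 fun F hF => ?_
    refine (measure_eq_zero_iff_ae_notMem.1 (volume_dropCoord_image_eq_zero i
      (T.face_isFlatFace F).measure_frontier)).and ?_
    by_cases h : N F i = 0
    · filter_upwards [measure_eq_zero_iff_ae_notMem.1 (volume_dropCoord_image_of_parallel i
        (hspec F hF).norm_eq_one ((hspec F hF).orthogonal _ (hx₀ F)) h)] with y hy _ using hy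
    · exact Filter.Eventually.of_forall fun y h' => absurd h' h
  have hdφ : Continuous fun x => fderiv ℝ φ x (EuclideanSpace.single i 1) :=
    (hφ.continuous_fderiv one_ne_zero).clm_apply continuous_const
  have hKm : MeasurableSet (T.cell K) := (T.cell_isCompact K).measurableSet
  have hline : ∀ᵐ y : Fin m → ℝ,
      ∫ r, (T.cell K).indicator (fun x => fderiv ℝ φ x (EuclideanSpace.single i 1))
        (insCoord i y r) = ∑ F ∈ T.facesOf K, (dropCoord i '' T.face F).indicator
          (fun y => (SignType.sign (N F i) : ℝ) * φ (insCoord i y (t F y))) y := by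
    filter_upwards [hae] with y hy
    have hiso := isometry_insCoord i y
    have hg : ContDiff ℝ 1 fun r => φ (insCoord i y r) := by
      refine hφ.comp ?_
      rw [show insCoord i y = fun r => insCoord i y 0 + r • EuclideanSpace.single i (1 : ℝ) from
        funext (insCoord_eq i y)]
      fun_prop
    have hgc : HasCompactSupport fun r => φ (insCoord i y r) :=
      hφc.comp_isClosedEmbedding hiso.isClosedEmbedding
    have hderiv : ∀ r, deriv (fun r => φ (insCoord i y r)) r =
        fderiv ℝ φ (insCoord i y r) (EuclideanSpace.single i 1) := by
      intro r
      have h1 : HasDerivAt (insCoord i y) (EuclideanSpace.single i (1 : ℝ)) r := by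
        rw [show insCoord i y = fun r => insCoord i y 0 + r • EuclideanSpace.single i (1 : ℝ) from
          funext (insCoord_eq i y)]
        simpa using ((hasDerivAt_id r).smul_const
          (EuclideanSpace.single i (1 : ℝ))).const_add (insCoord i y 0)
      exact ((hφ.differentiable one_ne_zero _).hasFDerivAt.comp_hasDerivAt r h1).deriv
    have hmem : ∀ F ∈ T.facesOf K, y ∈ dropCoord i '' T.face F →
        N F i ≠ 0 ∧ insCoord i y (t F y) ∈ intrinsicInterior ℝ (T.face F) := by
      intro F hF hyF
      have hni : N F i ≠ 0 := fun h => (hy F hF).2 h hyF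
      refine ⟨hni, IsFlatFace.mem_intrinsicInterior_of_notMem (hins F hF hni y hyF) fun h => ?_⟩
      exact (hy F hF).1 ⟨_, h, dropCoord_insCoord i _ _⟩
    have key := setIntegral_deriv_of_local_halfLine
      ((T.facesOf K).filter fun F => y ∈ dropCoord i '' T.face F) (fun F => t F y)
      (fun F => N F i) (insCoord i y ⁻¹' T.cell K) ?_ ?_ ?_ ?_ ?_ ?_ hg hgc
    · rw [← integral_indicator (hKm.preimage hiso.continuous.measurable),
        Finset.sum_filter] at key
      simp_rw [indicator_apply]
      rw [← key]
      refine integral_congr_ae (Filter.Eventually.of_forall fun r => ?_)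
      simp only [indicator_apply, hderiv, mem_preimage]
    · intro F hF
      rw [Finset.mem_filter] at hF
      exact (hmem F hF.1 hF.2).1
    -- Two faces crossed at the same parameter would share a relative interior point.
    · intro F hF F' hF' h
      rw [Finset.mem_coe, Finset.mem_filter] at hF hF'
      by_contra hne
      refine Set.disjoint_left.1 (T.face_disjoint hne) (hmem F hF.1 hF.2).2 ?_
      simp only at h
      rw [h]
      exact (hmem F' hF'.1 hF'.2).2
    · intro F hF
      rw [Finset.mem_filter] at hF
      obtain ⟨ε, hε, hball⟩ := (hspec F hF.1).local_halfSpace _ (hmem F hF.1 hF.2).2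
      filter_upwards [Metric.ball_mem_nhds (t F y) hε] with r hr
      rw [mem_preimage, hball _ (by rwa [Metric.mem_ball, hiso.dist_eq]), inner_sub_right,
        inner_insCoord i _ y r, inner_insCoord i _ y (t F y), add_sub_add_left_eq_sub, ← sub_mul,
        mul_comm]
    -- Away from the crossings the line avoids the frontier of the element, so it stays locally in
    -- the interior or in the open complement.
    · intro r hr
      have hnf : insCoord i y r ∉ frontier (T.cell K) := by
        intro h
        rw [T.frontier_cell, mem_iUnion₂] at h
        obtain ⟨F, hF, hx⟩ := h
        have hyF : y ∈ dropCoord i '' T.face F := ⟨_, hx, dropCoord_insCoord i _ _⟩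
        refine hr F (Finset.mem_filter.2 ⟨hF, hyF⟩) ?_
        have := hpt F hF (hmem F hF hyF).1 _ hx
        rw [dropCoord_insCoord, insCoord_same] at this
        exact this.symm
      by_cases hK : insCoord i y r ∈ T.cell K
      · have : insCoord i y r ∈ interior (T.cell K) := by
          by_contra h
          exact hnf ⟨subset_closure hK, h⟩
        left
        filter_upwards [hiso.continuous.continuousAt.preimage_mem_nhds
          (isOpen_interior.mem_nhds this)] with r' hr'
        exact mem_preimage.2 (interior_subset (s := T.cell K) hr')
      · right
        exact hiso.continuous.continuousAt.preimage_mem_nhds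
          ((T.cell_isCompact K).isClosed.isOpen_compl.mem_nhds hK)
    · exact hiso.antilipschitz.isBounded_preimage (T.cell_isCompact K).isBounded
    · exact hKm.preimage hiso.continuous.measurable
  have hint : Integrable ((T.cell K).indicator
      fun x => fderiv ℝ φ x (EuclideanSpace.single i 1)) := by
    rw [integrable_indicator_iff hKm]
    exact hdφ.continuousOn.integrableOn_compact (T.cell_isCompact K)
  have hcomp : ∀ F, IsCompact (dropCoord i '' T.face F) := fun F =>
    (T.face_isFlatFace F).isCompact.image (continuous_dropCoord i)
  have hcont : ∀ F, Continuous fun y => (SignType.sign (N F i) : ℝ) * φ (insCoord i y (t F y)) :=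
    fun F => continuous_const.mul (hφ.continuous.comp
      ((continuous_insCoord i).comp (continuous_id.prodMk (htc F))))
  rw [← integral_indicator hKm, integral_eq_integral_insCoord i hint, integral_congr_ae hline,
    integral_finsetSum]
  · refine Finset.sum_congr rfl fun F hF => ?_
    rw [integral_indicator (hcomp F).measurableSet]
    -- A parallel face contributes zero on both sides: its sign is zero, and so is the factor `n i`.
    by_cases hni : N F i = 0
    · simp [hni]
    · have hms : MeasurableSet (T.face F) := (T.face_isFlatFace F).isCompact.measurableSet
      rw [setIntegral_dropCoord_image i (hspec F hF).norm_eq_one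
        ((hspec F hF).orthogonal _ (hx₀ F)) hms hni (hcont F)]
      refine setIntegral_congr_fun hms fun x hx => ?_
      simp only
      rw [hpt F hF hni x hx, insCoord_dropCoord, ← mul_assoc, mul_comm |_|, sign_mul_abs, mul_comm]
  · intro F _
    rw [integrable_indicator_iff (hcomp F).measurableSet]
    exact (hcont F).continuousOn.integrableOn_compact (hcomp F)

/-- A function that is `C¹` at every point of a compact set agrees near this set with a compactly
supported `C¹` function. -/
theorem _root_.HDG.exists_contDiff_hasCompactSupport_eventuallyEq {s : Set (E d)} (hs : IsCompact s)
    {φ : E d → ℝ} (hφ : ∀ x ∈ s, ContDiffAt ℝ 1 φ x) :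
    ∃ ψ : E d → ℝ, ContDiff ℝ 1 ψ ∧ HasCompactSupport ψ ∧ ∀ x ∈ s, ψ =ᶠ[nhds x] φ := by
  let U : Set (E d) := {x | ∀ᶠ y in nhds x, ContDiffAt ℝ 1 φ y}
  have hU : IsOpen U := isOpen_setOfPred_eventually_nhds
  have hsU : s ⊆ U := fun x hx => (hφ x hx).eventually (by simp)
  -- Two nested compact neighbourhoods are needed: the cutoff is `1` on `L'`, which keeps the germs
  -- of `φ` along `s`, and `0` outside the interior of `L`, where `φ` may fail to be smooth.
  obtain ⟨L, hL, hsL, hLU⟩ := exists_compact_between hs hU hsU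
  obtain ⟨L', hL', hsL', hLL'⟩ := exists_compact_between hs isOpen_interior hsL
  obtain ⟨χ, hχ, -, hχ0, hχ1⟩ := exists_contMDiff_zero_iff_one_iff_of_isClosed
    (modelWithCornersSelf ℝ (E d)) (n := 1) (isOpen_interior (s := L)).isClosed_compl hL'.isClosed
    (disjoint_compl_left_iff_subset.2 hLL')
  have hχc : ContDiff ℝ 1 χ := hχ.contDiff
  have hsupp : Function.support (fun x => χ x * φ x) ⊆ L := by
    intro x hx
    by_contra h
    refine hx ?_
    simp only
    rw [(hχ0 x).1 fun h' => h (interior_subset h'), zero_mul]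
  have htsupp : tsupport (fun x => χ x * φ x) ⊆ L := closure_minimal hsupp hL.isClosed
  refine ⟨fun x => χ x * φ x, ?_, HasCompactSupport.of_support_subset_isCompact hL hsupp, ?_⟩
  · refine contDiff_iff_contDiffAt.2 fun x => ?_
    by_cases hx : x ∈ tsupport fun x => χ x * φ x
    · exact hχc.contDiffAt.mul (hLU (htsupp hx)).self_of_nhds
    · exact contDiffAt_const.congr_of_eventuallyEq (notMem_tsupport_iff_eventuallyEq.1 hx)
  · intro x hx
    filter_upwards [isOpen_interior.mem_nhds (hsL' hx)] with y hy
    rw [(hχ1 y).1 (interior_subset hy), one_mul]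

/-- Both sides depend only on the germs of `φ` along `K`, so `φ` may be replaced by a compactly
supported function. -/
theorem setIntegral_partialDeriv (T : Mesh d Ω) (K : T.Cell) (i : Fin d) {φ : E d → ℝ}
    (hφ : ∀ x ∈ T.cell K, ContDiffAt ℝ 1 φ x) :
    ∫ x in T.cell K, fderiv ℝ φ x (EuclideanSpace.single i 1) =
      ∑ F ∈ T.facesOf K, ∫ x, φ x * T.normal K F i ∂(T.faceMeasure F) := by
  rcases d with _ | m
  · exact i.elim0
  obtain ⟨ψ, hψ, hψc, hψφ⟩ :=
    exists_contDiff_hasCompactSupport_eventuallyEq (T.cell_isCompact K) hφ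
  have h := T.setIntegral_partialDeriv_of_hasCompactSupport K i hψ hψc
  have h1 : ∫ x in T.cell K, fderiv ℝ φ x (EuclideanSpace.single i 1) =
      ∫ x in T.cell K, fderiv ℝ ψ x (EuclideanSpace.single i 1) :=
    setIntegral_congr_fun (T.cell_isCompact K).measurableSet fun x hx => by
      simp only [(hψφ x hx).fderiv_eq]
  rw [h1, h]
  refine Finset.sum_congr rfl fun F hF => ?_
  refine setIntegral_congr_fun (T.face_isFlatFace F).isCompact.measurableSet fun x hx => ?_
  simp only [(hψφ x (T.face_subset_cell hF hx)).eq_of_nhds]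

theorem integrable_faceMeasure_of_continuousOn (T : Mesh d Ω) {F : T.Face} {g : E d → ℝ}
    (hg : ContinuousOn g (T.face F)) : Integrable g (T.faceMeasure F) := by
  have hK := (T.face_isFlatFace F).isCompact
  obtain ⟨C, hC⟩ := hK.exists_bound_of_continuousOn hg
  have hm := hK.measurableSet
  refine Integrable.of_bound (hg.aestronglyMeasurable hm) C ?_
  exact (ae_restrict_iff' hm).2 (Filter.Eventually.of_forall hC)

theorem memLp_faceMeasure_of_continuousOn (T : Mesh d Ω) {F : T.Face} {g : E d → ℝ}
    (hg : ContinuousOn g (T.face F)) : MemLp g 2 (T.faceMeasure F) := by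
  have hK := (T.face_isFlatFace F).isCompact
  obtain ⟨C, hC⟩ := hK.exists_bound_of_continuousOn hg
  have hm := hK.measurableSet
  refine MemLp.of_bound (hg.aestronglyMeasurable hm) C ?_
  exact (ae_restrict_iff' hm).2 (Filter.Eventually.of_forall hC)

/-- Integration by parts on an element: `(u, ∇ · v)_K + (∇ u, v)_K = ⟨u, v · n⟩_{∂K}`. -/
theorem integral_mul_dvg_add_inner_gradient (T : Mesh d Ω) (K : T.Cell) {u : E d → ℝ}
    {v : E d → E d} (hu : ∀ x ∈ T.cell K, ContDiffAt ℝ 1 u x)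
    (hv : ∀ x ∈ T.cell K, ContDiffAt ℝ 1 v x) :
    (∫ x in T.cell K, u x * ∑ i : Fin d, fderiv ℝ v x (EuclideanSpace.single i 1) i)
        + ∫ x in T.cell K, inner ℝ (gradient u x) (v x) =
      ∑ F ∈ T.facesOf K, ∫ x, u x * inner ℝ (v x) (T.normal K F) ∂(T.faceMeasure F) := by
  have hKc := T.cell_isCompact K
  have hKm := hKc.measurableSet
  have hvi : ∀ i, ∀ x ∈ T.cell K, ContDiffAt ℝ 1 (fun x => v x i) x := fun i x hx =>
    contDiffAt_euclidean.1 (hv x hx) i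
  have huc : ContinuousOn u (T.cell K) := fun x hx => (hu x hx).continuousAt.continuousWithinAt
  have hvc : ContinuousOn v (T.cell K) := fun x hx => (hv x hx).continuousAt.continuousWithinAt
  have hu' : ContinuousOn (fderiv ℝ u) (T.cell K) := fun x hx =>
    ((hu x hx).fderiv_right (m := 0) le_rfl).continuousAt.continuousWithinAt
  have hv' : ContinuousOn (fderiv ℝ v) (T.cell K) := fun x hx =>
    ((hv x hx).fderiv_right (m := 0) le_rfl).continuousAt.continuousWithinAt
  have hgrad : ∀ x i, gradient u x i = fderiv ℝ u x (EuclideanSpace.single i 1) := by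
    intro x i
    rw [gradient, ← InnerProductSpace.toDual_symm_apply (𝕜 := ℝ) (y := fderiv ℝ u x),
      EuclideanSpace.inner_single_right]
    simp
  have hprod : ∀ i, ∀ x ∈ T.cell K,
      fderiv ℝ (fun x => u x * v x i) x (EuclideanSpace.single i 1) =
        u x * fderiv ℝ v x (EuclideanSpace.single i 1) i + gradient u x i * v x i := by
    intro i x hx
    have h1 := (hu x hx).differentiableAt one_ne_zero
    have h2 := (hv x hx).differentiableAt one_ne_zero
    have h3 : HasFDerivAt (fun x => v x i)
        ((EuclideanSpace.proj i : E d →L[ℝ] ℝ).comp (fderiv ℝ v x)) x :=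
      (EuclideanSpace.proj i : E d →L[ℝ] ℝ).hasFDerivAt.comp x h2.hasFDerivAt
    have h4 : HasFDerivAt (fun x => u x * v x i) _ x := h1.hasFDerivAt.mul h3
    rw [h4.fderiv, hgrad]
    simp [mul_comm]
  have hdiv : IntegrableOn
      (fun x => u x * ∑ i : Fin d, fderiv ℝ v x (EuclideanSpace.single i 1) i) (T.cell K) := by
    refine ContinuousOn.integrableOn_compact hKc ?_
    refine huc.mul (continuousOn_finsetSum _ fun i _ => ?_)
    exact (EuclideanSpace.proj i : E d →L[ℝ] ℝ).continuous.comp_continuousOn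
      (hv'.clm_apply continuousOn_const)
  have hgi : IntegrableOn (fun x => inner ℝ (gradient u x) (v x)) (T.cell K) := by
    refine ContinuousOn.integrableOn_compact hKc ?_
    exact ((InnerProductSpace.toDual ℝ (E d)).symm.continuous.comp_continuousOn hu').inner hvc
  rw [← integral_add hdiv hgi]
  have hsum : ∀ x ∈ T.cell K,
      u x * ∑ i : Fin d, fderiv ℝ v x (EuclideanSpace.single i 1) i + inner ℝ (gradient u x) (v x)
        = ∑ i, fderiv ℝ (fun x => u x * v x i) x (EuclideanSpace.single i 1) := by
    intro x hx
    simp_rw [hprod _ x hx, Finset.sum_add_distrib, Finset.mul_sum, PiLp.inner_apply]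
    congr 1
    exact Finset.sum_congr rfl fun i _ => by simp [mul_comm]
  rw [setIntegral_congr_fun hKm hsum, integral_finsetSum]
  · simp_rw [T.setIntegral_partialDeriv K _ fun x hx => (hu x hx).mul (hvi _ x hx)]
    rw [Finset.sum_comm]
    refine Finset.sum_congr rfl fun F hF => ?_
    have hsub := T.face_subset_cell hF
    rw [← integral_finsetSum]
    · refine integral_congr_ae (Filter.Eventually.of_forall fun x => ?_)
      simp only [PiLp.inner_apply, Finset.mul_sum]
      exact Finset.sum_congr rfl fun i _ => by simp; ring
    · intro i _
      refine T.integrable_faceMeasure_of_continuousOn ?_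
      refine ((huc.mono hsub).mul fun x hx => ?_).mul continuousOn_const
      exact (hvi i x (hsub hx)).continuousAt.continuousWithinAt
  · intro i _
    refine ContinuousOn.integrableOn_compact hKc (fun x hx => ?_)
    have h := ((hu x hx).mul (hvi i x hx)).fderiv_right (m := 0) le_rfl
    exact h.continuousAt.continuousWithinAt.clm_apply continuousWithinAt_const

/-! ### Geometry of the faces -/

/-- A point of the face lies on the frontier and hence differs from an interior point of the
element. Positivity is what makes `ρ / h` invertible. -/
theorem h_pos (T : Mesh d Ω) {K : T.Cell} {F : T.Face} (hF : F ∈ T.facesOf K) : 0 < T.h K := by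
  obtain ⟨x, hx⟩ := (T.face_isFlatFace F).nonempty
  have hxf : x ∈ frontier (T.cell K) := by
    rw [T.frontier_cell]
    exact mem_biUnion hF hx
  have hne : (interior (T.cell K)).Nonempty := by
    rw [← closure_nonempty_iff, ← T.cell_eq_closure K]
    exact T.cell_nonempty K
  obtain ⟨y, hy⟩ := hne
  have hxy : x ≠ y := fun h => hxf.2 (h ▸ hy)
  exact (dist_pos.2 hxy).trans_le (Metric.dist_le_diam_of_mem (T.cell_isCompact K).isBounded
    (T.face_subset_cell hF hx) (interior_subset hy))

/-- The unit normal to a flat face is unique up to sign. -/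
theorem normal_eq_or_eq_neg (T : Mesh d Ω) {K K' : T.Cell} {F : T.Face} (hK : F ∈ T.facesOf K)
    (hK' : F ∈ T.facesOf K') :
    T.normal K' F = T.normal K F ∨ T.normal K' F = -T.normal K F := by
  have hn := T.normal_spec K F hK
  have hn' := T.normal_spec K' F hK'
  have hF := T.face_isFlatFace F
  set W := (affineSpan ℝ (T.face F)).direction with hW
  have hWo : ∀ n : E d, (∀ x ∈ T.face F, ∀ y ∈ T.face F, inner ℝ n (y - x) = 0) → n ∈ Wᗮ := by
    intro n h
    rw [Submodule.mem_orthogonal', hW, direction_affineSpan, vectorSpan_def]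
    intro w hw
    induction hw using Submodule.span_induction with
    | mem w hw =>
      obtain ⟨a, ha, b, hb, rfl⟩ := hw
      exact h b hb a ha
    | zero => simp
    | add a b _ _ ha hb => rw [inner_add_right, ha, hb, add_zero]
    | smul r a _ ha => rw [inner_smul_right, ha, mul_zero]
  -- Both normals lie in the orthogonal complement of the face direction, a line, so they are
  -- proportional unit vectors.
  have hrank : Module.finrank ℝ Wᗮ = 1 := by
    have h1 := Submodule.finrank_add_finrank_orthogonal W
    have h2 : Module.finrank ℝ W + 1 = d := hF.finrank_direction
    rw [finrank_euclideanSpace_fin] at h1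
    omega
  have hn0 : (⟨T.normal K F, hWo _ hn.orthogonal⟩ : Wᗮ) ≠ 0 := by
    intro h
    have := congrArg Subtype.val h
    have h2 := hn.norm_eq_one
    simp only at this
    rw [this] at h2
    simp at h2
  obtain ⟨c, hc⟩ := (finrank_eq_one_iff_of_nonzero' _ hn0).1 hrank
    ⟨T.normal K' F, hWo _ hn'.orthogonal⟩
  have hc' : c • T.normal K F = T.normal K' F := congrArg Subtype.val hc
  have hcn : |c| = 1 := by
    have := hn'.norm_eq_one
    rwa [← hc', norm_smul, hn.norm_eq_one, mul_one, Real.norm_eq_abs] at this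
  rcases (abs_eq zero_le_one).1 hcn with h | h
  · left; rw [← hc', h, one_smul]
  · right; rw [← hc', h, neg_smul, one_smul]

/-- The outward unit normals to two elements sharing a face are opposite. -/
theorem normal_eq_neg (T : Mesh d Ω) {K K' : T.Cell} {F : T.Face} (hne : K ≠ K')
    (hK : F ∈ T.facesOf K) (hK' : F ∈ T.facesOf K') : T.normal K' F = -T.normal K F := by
  refine (T.normal_eq_or_eq_neg hK hK').resolve_left fun h => ?_
  obtain ⟨x, hx⟩ := (T.face_isFlatFace F).nonempty_intrinsicInterior
  obtain ⟨ε, hε, hball⟩ := (T.normal_spec K F hK).local_halfSpace x hx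
  obtain ⟨ε', hε', hball'⟩ := (T.normal_spec K' F hK').local_halfSpace x hx
  have hxK : x ∈ closure (interior (T.cell K)) := by
    rw [← T.cell_eq_closure]
    exact T.face_subset_cell hK (intrinsicInterior_subset hx)
  -- With equal normals both elements would coincide in `B` with the same half-space, so an interior
  -- point of `K` in `B` would also be interior to `K'`.
  let B := Metric.ball x ε ∩ Metric.ball x ε'
  have hB : IsOpen B := Metric.isOpen_ball.inter Metric.isOpen_ball
  obtain ⟨y, hyB, hy⟩ := mem_closure_iff.1 hxK B hB
    ⟨Metric.mem_ball_self hε, Metric.mem_ball_self hε'⟩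
  refine disjoint_left.1 (T.cell_disjoint hne) hy ?_
  rw [mem_interior]
  refine ⟨B ∩ interior (T.cell K), fun z hz => ?_, hB.inter isOpen_interior, hyB, hy⟩
  rw [hball' z hz.1.2, h, ← hball z hz.1.1]
  exact interior_subset hz.2

/-- An element having `F` as a face. -/
def someCell (T : Mesh d Ω) (F : T.Face) : T.Cell := (T.exists_mem_facesOf F).choose

theorem mem_facesOf_someCell (T : Mesh d Ω) (F : T.Face) : F ∈ T.facesOf (T.someCell F) :=
  (T.exists_mem_facesOf F).choose_spec

theorem eq_someCell_of_isBoundary (T : Mesh d Ω) {K : T.Cell} {F : T.Face} (hb : T.IsBoundary F)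
    (hK : F ∈ T.facesOf K) : K = T.someCell F := by
  obtain ⟨a, ha⟩ := ncard_eq_one.1 (T.boundary_face F hb)
  have h1 : K ∈ {K | F ∈ T.facesOf K} := hK
  have h2 : T.someCell F ∈ {K | F ∈ T.facesOf K} := T.mem_facesOf_someCell F
  rw [ha, mem_singleton_iff] at h1 h2
  rw [h1, h2]

open Classical in
theorem exists_pair_of_not_isBoundary (T : Mesh d Ω) {F : T.Face} (hb : ¬ T.IsBoundary F) :
    ∃ K', T.someCell F ≠ K' ∧ F ∈ T.facesOf K' ∧
      (Finset.univ.filter fun K => F ∈ T.facesOf K) = {T.someCell F, K'} := by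
  obtain ⟨a, b, hab, h⟩ := ncard_eq_two.1 (T.interior_face F hb)
  have hmem : ∀ K, F ∈ T.facesOf K ↔ K = a ∨ K = b := fun K => by
    change K ∈ {K | F ∈ T.facesOf K} ↔ _
    rw [h]; simp
  rcases (hmem _).1 (T.mem_facesOf_someCell F) with h1 | h1
  · refine ⟨b, h1 ▸ hab, (hmem b).2 (Or.inr rfl), ?_⟩
    ext K; simp [hmem, h1]
  · refine ⟨a, h1 ▸ hab.symm, (hmem a).2 (Or.inl rfl), ?_⟩
    ext K; simp [hmem, h1, or_comm]

-- Regrouping by faces collects the contributions of the one or two elements adjacent to each face,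
-- where jumps and cancellations become visible.
open Classical in
theorem sum_facesOf_comm (T : Mesh d Ω) (p : T.Face → Prop) (a : T.Cell → T.Face → ℝ) :
    ∑ K, ∑ F ∈ (T.facesOf K).filter p, a K F =
      ∑ F ∈ Finset.univ.filter p, ∑ K ∈ Finset.univ.filter (fun K => F ∈ T.facesOf K), a K F :=
  Finset.sum_comm' fun K F => by simp [and_comm]

/-! ### Functions in `L²` of the faces -/

theorem toL2_of_memLp (T : Mesh d Ω) {F : T.Face} {g : E d → ℝ} (hg : MemLp g 2 (T.faceMeasure F)) :
    T.toL2 F g = hg.toLp g := by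
  simp [toL2, hg]

theorem coeFn_toL2 (T : Mesh d Ω) {F : T.Face} {g : E d → ℝ} (hg : MemLp g 2 (T.faceMeasure F)) :
    T.toL2 F g =ᵐ[T.faceMeasure F] g := by
  rw [T.toL2_of_memLp hg]
  exact hg.coeFn_toLp

/-- Agreement with an `L²` class already makes `g` square integrable, so the default value of `toL2`
does not occur. -/
theorem toL2_eq_of_ae_eq (T : Mesh d Ω) {F : T.Face} {g : E d → ℝ} {a : T.L2 F}
    (h : g =ᵐ[T.faceMeasure F] a) : T.toL2 F g = a := by
  have hg : MemLp g 2 (T.faceMeasure F) := (memLp_congr_ae h).2 (Lp.memLp a)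
  exact Lp.ext ((T.coeFn_toL2 hg).trans h)

theorem toL2_coe (T : Mesh d Ω) {F : T.Face} (a : T.L2 F) : T.toL2 F a = a :=
  T.toL2_eq_of_ae_eq (ae_eq_refl _)

theorem toL2_sub (T : Mesh d Ω) {F : T.Face} {g g' : E d → ℝ} (hg : MemLp g 2 (T.faceMeasure F))
    (hg' : MemLp g' 2 (T.faceMeasure F)) :
    T.toL2 F (fun x => g x - g' x) = T.toL2 F g - T.toL2 F g' :=
  T.toL2_eq_of_ae_eq
    (((T.coeFn_toL2 hg).sub (T.coeFn_toL2 hg')).symm.trans (Lp.coeFn_sub _ _).symm)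

theorem toL2_const_mul (T : Mesh d Ω) {F : T.Face} {g : E d → ℝ} (r : ℝ)
    (hg : MemLp g 2 (T.faceMeasure F)) : T.toL2 F (fun x => r * g x) = r • T.toL2 F g :=
  T.toL2_eq_of_ae_eq (((T.coeFn_toL2 hg).const_smul r).symm.trans (Lp.coeFn_smul _ _).symm)

theorem integral_mul_eq_inner (T : Mesh d Ω) {F : T.Face} {a b : E d → ℝ}
    (ha : MemLp a 2 (T.faceMeasure F)) (hb : MemLp b 2 (T.faceMeasure F)) :
    ∫ x, a x * b x ∂(T.faceMeasure F) = inner ℝ (T.toL2 F a) (T.toL2 F b) := by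
  rw [L2.inner_def]
  refine integral_congr_ae ?_
  filter_upwards [T.coeFn_toL2 ha, T.coeFn_toL2 hb] with x h1 h2
  simp [h1, h2, mul_comm]

open Classical in
theorem facePairOn_eq_sum_inner (T : Mesh d Ω) (p : T.Face → Prop)
    {a b : T.Cell → T.Face → E d → ℝ}
    (ha : ∀ K, ∀ F ∈ T.facesOf K, MemLp (a K F) 2 (T.faceMeasure F))
    (hb : ∀ K, ∀ F ∈ T.facesOf K, MemLp (b K F) 2 (T.faceMeasure F)) :
    T.facePairOn p a b = ∑ K, ∑ F ∈ (T.facesOf K).filter p,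
      inner ℝ (T.toL2 F (a K F)) (T.toL2 F (b K F)) := by
  unfold facePairOn
  refine Finset.sum_congr rfl fun K _ => Finset.sum_congr (by congr) fun F hF => ?_
  have hF' := (Finset.mem_filter.1 hF).1
  exact T.integral_mul_eq_inner (ha K F hF') (hb K F hF')

theorem facePair_eq_sum_inner (T : Mesh d Ω) {a b : T.Cell → T.Face → E d → ℝ}
    (ha : ∀ K, ∀ F ∈ T.facesOf K, MemLp (a K F) 2 (T.faceMeasure F))
    (hb : ∀ K, ∀ F ∈ T.facesOf K, MemLp (b K F) 2 (T.faceMeasure F)) :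
    T.facePair a b = ∑ K, ∑ F ∈ T.facesOf K, inner ℝ (T.toL2 F (a K F)) (T.toL2 F (b K F)) := by
  unfold facePair
  rw [T.facePairOn_eq_sum_inner _ ha hb]
  simp

theorem facePair_eq_sum (T : Mesh d Ω) (a b : T.Cell → T.Face → E d → ℝ) :
    T.facePair a b = ∑ K, ∑ F ∈ T.facesOf K, ∫ x, a K F x * b K F x ∂(T.faceMeasure F) := by
  simp [facePair, facePairOn]

theorem facePairOn_congr (T : Mesh d Ω) {p : T.Face → Prop} {a a' b b' : T.Cell → T.Face → E d → ℝ}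
    (ha : ∀ K, ∀ F ∈ T.facesOf K, p F → a K F =ᵐ[T.faceMeasure F] a' K F)
    (hb : ∀ K, ∀ F ∈ T.facesOf K, p F → b K F =ᵐ[T.faceMeasure F] b' K F) :
    T.facePairOn p a b = T.facePairOn p a' b' := by
  classical
  unfold facePairOn
  refine Finset.sum_congr rfl fun K _ => Finset.sum_congr rfl fun F hF => ?_
  have hF' := Finset.mem_filter.1 hF
  refine integral_congr_ae ?_
  filter_upwards [ha K F hF'.1 hF'.2, hb K F hF'.1 hF'.2] with x h1 h2
  rw [h1, h2]

theorem facePairOn_comm (T : Mesh d Ω) (p : T.Face → Prop) (a b : T.Cell → T.Face → E d → ℝ) :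
    T.facePairOn p a b = T.facePairOn p b a := by
  simp only [facePairOn, mul_comm]

theorem facePair_eq_facePairInt_add_facePairBdry (T : Mesh d Ω)
    (a b : T.Cell → T.Face → E d → ℝ) :
    T.facePair a b = T.facePairInt a b + T.facePairBdry a b := by
  classical
  rw [facePair_eq_sum]
  unfold facePairInt facePairBdry facePairOn
  rw [← Finset.sum_add_distrib]
  refine Finset.sum_congr rfl fun K _ => ?_
  rw [add_comm, ← Finset.sum_filter_add_sum_filter_not (T.facesOf K) T.IsBoundary]
  congr!

theorem memLp_normalComp (T : Mesh d Ω) (ν : ∀ F : T.Face, Lp (E d) 2 (T.faceMeasure F))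
    (K : T.Cell) (F : T.Face) : MemLp (T.normalComp ν K F) 2 (T.faceMeasure F) :=
  (Lp.memLp (ν F)).inner_const (𝕜 := ℝ) (T.normal K F)

theorem coeFn_toL2_normalComp (T : Mesh d Ω) (ν : ∀ F : T.Face, Lp (E d) 2 (T.faceMeasure F))
    (K : T.Cell) (F : T.Face) :
    T.toL2 F (T.normalComp ν K F) =ᵐ[T.faceMeasure F] T.normalComp ν K F :=
  T.coeFn_toL2 (T.memLp_normalComp ν K F)

theorem memLp_single (T : Mesh d Ω) (μ : ∀ F, T.L2 F) (K : T.Cell) (F : T.Face) :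
    MemLp (T.single μ K F) 2 (T.faceMeasure F) :=
  Lp.memLp (μ F)

theorem toL2_normalComp_eq_neg (T : Mesh d Ω) (ν : ∀ F : T.Face, Lp (E d) 2 (T.faceMeasure F))
    {K K' : T.Cell} {F : T.Face} (hne : K ≠ K') (hK : F ∈ T.facesOf K) (hK' : F ∈ T.facesOf K') :
    T.toL2 F (T.normalComp ν K' F) = -T.toL2 F (T.normalComp ν K F) := by
  refine T.toL2_eq_of_ae_eq (Filter.EventuallyEq.trans ?_ (Lp.coeFn_neg _).symm)
  filter_upwards [T.coeFn_toL2_normalComp ν K F] with x hx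
  rw [Pi.neg_apply, hx]
  simp [normalComp, T.normal_eq_neg hne hK hK', inner_neg_right]

/-- The normal components of a single-valued function cancel on interior faces. -/
theorem facePairInt_single_normalComp (T : Mesh d Ω) (μ : ∀ F, T.L2 F)
    (ν : ∀ F : T.Face, Lp (E d) 2 (T.faceMeasure F)) :
    T.facePairInt (T.single μ) (T.normalComp ν) = 0 := by
  classical
  unfold facePairInt
  rw [T.facePairOn_eq_sum_inner _ (fun K F _ => T.memLp_single μ K F)
    (fun K F _ => T.memLp_normalComp ν K F), sum_facesOf_comm]
  refine Finset.sum_eq_zero fun F hF => ?_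
  obtain ⟨K', hne, hK', h⟩ := T.exists_pair_of_not_isBoundary (F := F) (by simpa using hF)
  rw [h, Finset.sum_pair hne, T.toL2_normalComp_eq_neg ν hne (T.mem_facesOf_someCell F) hK',
    inner_neg_right]
  exact add_neg_cancel _

/-- The vector function `g n` on a face, for a scalar function `g` and a vector `n`. -/
def smulVec (T : Mesh d Ω) (F : T.Face) (g : T.L2 F) (n : E d) : Lp (E d) 2 (T.faceMeasure F) :=
  (ContinuousLinearMap.toSpanSingleton ℝ n).compLp g

theorem toL2_normalComp_of_eq_smulVec (T : Mesh d Ω)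
    {ν : ∀ F : T.Face, Lp (E d) 2 (T.faceMeasure F)} {F : T.Face} {g : T.L2 F} {n : E d}
    (hν : ν F = T.smulVec F g n) (K : T.Cell) :
    T.toL2 F (T.normalComp ν K F) = (inner ℝ n (T.normal K F) : ℝ) • g := by
  refine T.toL2_eq_of_ae_eq (Filter.EventuallyEq.trans ?_ (Lp.coeFn_smul _ _).symm)
  unfold normalComp
  rw [hν]
  filter_upwards [(ContinuousLinearMap.toSpanSingleton ℝ n).coeFn_compLp g] with x hx
  change inner ℝ ((ContinuousLinearMap.toSpanSingleton ℝ n).compLp g x) _ = _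
  rw [hx]
  simp [inner_smul_left, mul_comm]

theorem inner_normal_self (T : Mesh d Ω) {K : T.Cell} {F : T.Face} (hK : F ∈ T.facesOf K) :
    (inner ℝ (T.normal K F) (T.normal K F) : ℝ) = 1 := by
  rw [real_inner_self_eq_norm_sq, (T.normal_spec K F hK).norm_eq_one, one_pow]

/-- Integration by parts, element by element. -/
theorem volPair_dvg_add_volPairVec_grad (T : Mesh d Ω) {u : T.Cell → E d → ℝ}
    {v : T.Cell → E d → E d} (hu : ∀ K, ∀ x ∈ T.cell K, ContDiffAt ℝ 1 (u K) x)
    (hv : ∀ K, ∀ x ∈ T.cell K, ContDiffAt ℝ 1 (v K) x) :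
    T.volPair u (dvg v) + T.volPairVec (grad u) v = T.facePair (T.trace u) (T.normalTrace v) := by
  rw [facePair_eq_sum]
  unfold volPair volPairVec
  rw [← Finset.sum_add_distrib]
  exact Finset.sum_congr rfl fun K _ => T.integral_mul_dvg_add_inner_gradient K (hu K) (hv K)

end Mesh

/-! ### Traces of the local spaces and the projection onto `M(F)` -/

namespace LocalSpaces

variable {T : Mesh d Ω} (S : LocalSpaces T)

theorem memLp_normalTrace {q : T.Cell → E d → E d} (hq : q ∈ S.Vh) (K : T.Cell) (F : T.Face)
    (hF : F ∈ T.facesOf K) : MemLp (T.normalTrace q K F) 2 (T.faceMeasure F) := by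
  refine T.memLp_faceMeasure_of_continuousOn fun x hx => ?_
  exact ((S.V_contDiffAt K _ (hq K) x (T.face_subset_cell hF hx)).continuousAt.inner
    continuousAt_const).continuousWithinAt

theorem memLp_trace {u : T.Cell → E d → ℝ} (hu : u ∈ S.Wh) (K : T.Cell) (F : T.Face)
    (hF : F ∈ T.facesOf K) : MemLp (T.trace u K F) 2 (T.faceMeasure F) :=
  T.memLp_faceMeasure_of_continuousOn fun x hx =>
    (S.W_contDiffAt K _ (hu K) x (T.face_subset_cell hF hx)).continuousAt.continuousWithinAt

theorem PM_mem (F : T.Face) (a : T.L2 F) : S.PM F a ∈ S.M F :=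
  Submodule.starProjection_apply_mem _ _

theorem PM_eq_self {F : T.Face} {a : T.L2 F} (ha : a ∈ S.M F) : S.PM F a = a :=
  Submodule.starProjection_eq_self_iff.2 ha

/-- Self-adjointness of the projection. It removes `P_M` from `P_M u_h` in every pairing with a
normal trace. -/
theorem inner_PM_left {F : T.Face} (a : T.L2 F) {b : T.L2 F} (hb : b ∈ S.M F) :
    (inner ℝ (S.PM F a) b : ℝ) = inner ℝ a b := by
  have h := Submodule.inner_starProjection_left_eq_right (S.M F) a b
  have h2 : (S.M F).starProjection b = b := Submodule.starProjection_eq_self_iff.2 hb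
  rw [h2] at h
  exact h


end LocalSpaces

/-! ### Correspondence between scalar face functions and normal components -/

namespace Mesh

/-- The vector function on the faces whose normal component, seen from the element `T.someCell F`,
is `μ F`. -/
def normalLift (T : Mesh d Ω) (μ : ∀ F, T.L2 F) (F : T.Face) : Lp (E d) 2 (T.faceMeasure F) :=
  T.smulVec F (μ F) (T.normal (T.someCell F) F)

theorem toL2_normalComp_normalLift (T : Mesh d Ω) (μ : ∀ F, T.L2 F) (K : T.Cell) (F : T.Face) :
    T.toL2 F (T.normalComp (T.normalLift μ) K F) =
      (inner ℝ (T.normal (T.someCell F) F) (T.normal K F) : ℝ) • μ F :=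
  T.toL2_normalComp_of_eq_smulVec rfl K

theorem toL2_normalComp_normalLift_someCell (T : Mesh d Ω) (μ : ∀ F, T.L2 F) (F : T.Face) :
    T.toL2 F (T.normalComp (T.normalLift μ) (T.someCell F) F) = μ F := by
  rw [toL2_normalComp_normalLift, T.inner_normal_self (T.mem_facesOf_someCell F), one_smul]

theorem normalComp_normalLift_of_isBoundary (T : Mesh d Ω) (μ : ∀ F, T.L2 F) {K : T.Cell}
    {F : T.Face} (hF : F ∈ T.facesOf K) (hb : T.IsBoundary F) :
    T.normalComp (T.normalLift μ) K F =ᵐ[T.faceMeasure F] μ F := by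
  refine (T.coeFn_toL2_normalComp _ K F).symm.trans ?_
  rw [T.eq_someCell_of_isBoundary hb hF, toL2_normalComp_normalLift_someCell]

/-- The normal component of `ν` on each face, seen from the element `T.someCell F`. -/
def someNormalComp (T : Mesh d Ω) (ν : ∀ F : T.Face, Lp (E d) 2 (T.faceMeasure F)) (F : T.Face) :
    T.L2 F :=
  T.toL2 F (T.normalComp ν (T.someCell F) F)

theorem someNormalComp_of_isBoundary (T : Mesh d Ω)
    (ν : ∀ F : T.Face, Lp (E d) 2 (T.faceMeasure F)) {K : T.Cell}
    {F : T.Face} (hF : F ∈ T.facesOf K) (hb : T.IsBoundary F) :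
    T.someNormalComp ν F =ᵐ[T.faceMeasure F] T.normalComp ν K F := by
  rw [T.eq_someCell_of_isBoundary hb hF]
  exact T.coeFn_toL2_normalComp ν _ F

theorem facePair_single_normalComp (T : Mesh d Ω) (μ : ∀ F, T.L2 F)
    (ν : ∀ F : T.Face, Lp (E d) 2 (T.faceMeasure F)) :
    T.facePair (T.single μ) (T.normalComp ν) = T.facePairBdry (T.single μ) (T.normalComp ν) := by
  rw [facePair_eq_facePairInt_add_facePairBdry, facePairInt_single_normalComp, zero_add]

theorem toL2_single (T : Mesh d Ω) (μ : ∀ F, T.L2 F) (K : T.Cell) (F : T.Face) :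
    T.toL2 F (T.single μ K F) = μ F :=
  T.toL2_coe (μ F)

theorem normalComp_zero (T : Mesh d Ω) (K : T.Cell) (F : T.Face) :
    T.normalComp (0 : ∀ F : T.Face, Lp (E d) 2 (T.faceMeasure F)) K F =ᵐ[T.faceMeasure F] 0 := by
  filter_upwards [Lp.coeFn_zero (E d) 2 (T.faceMeasure F)] with x hx
  simp only [normalComp, Pi.zero_apply]
  rw [hx]
  simp

theorem facePairOn_normalComp_zero (T : Mesh d Ω) (p : T.Face → Prop)
    (a : T.Cell → T.Face → E d → ℝ) :
    T.facePairOn p a (T.normalComp 0) = 0 := by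
  rw [T.facePairOn_congr (a' := a) (b' := fun _ _ => 0) (fun _ _ _ _ => ae_eq_refl _)
    fun K F _ _ => T.normalComp_zero K F]
  simp [facePairOn]

end Mesh

/-! ### Admissible test functions, fluxes and eliminated traces -/

namespace LocalSpaces

variable {T : Mesh d Ω} (S : LocalSpaces T)

theorem normalLift_mem_Nh {μ : ∀ F, T.L2 F} (hμ : μ ∈ S.Mh) : T.normalLift μ ∈ S.Nh := by
  intro K F _
  rw [T.toL2_normalComp_normalLift]
  exact (S.M F).smul_mem _ (hμ F)

theorem someNormalComp_mem_Mh {ν : ∀ F : T.Face, Lp (E d) 2 (T.faceMeasure F)} (hν : ν ∈ S.Nh) :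
    T.someNormalComp ν ∈ S.Mh :=
  fun F => hν _ F (T.mem_facesOf_someCell F)

theorem update_zero_mem_Mh [DecidableEq T.Face] {F : T.Face} {g : T.L2 F} (hg : g ∈ S.M F) :
    Function.update (0 : ∀ F, T.L2 F) F g ∈ S.Mh := by
  intro F'
  rcases eq_or_ne F' F with rfl | h
  · simpa using hg
  · rw [Function.update_of_ne h]
    exact (S.M F').zero_mem

theorem zero_mem_Nh : (0 : ∀ F : T.Face, Lp (E d) 2 (T.faceMeasure F)) ∈ S.Nh := by
  intro K F _
  rw [T.toL2_eq_of_ae_eq ((T.normalComp_zero K F).trans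
    (Lp.coeFn_zero ℝ 2 (T.faceMeasure F)).symm)]
  exact (S.M F).zero_mem

variable {S} {ρ : ℝ}

theorem numFlux_mem (hS : S.NormalTracesIn) {q : T.Cell → E d → E d} (hq : q ∈ S.Vh)
    (u : T.Cell → E d → ℝ) (uhat : ∀ F, T.L2 F) {K : T.Cell} {F : T.Face}
    (hF : F ∈ T.facesOf K) : numFlux T (S.lsStab ρ) q u uhat K F ∈ S.M F :=
  (S.M F).add_mem (hS K F hF _ (hq K)) ((S.M F).smul_mem _ (S.PM_mem F _))

theorem elimTrace_eq {q : T.Cell → E d → E d} (hq : q ∈ S.Vh) (u : T.Cell → E d → ℝ)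
    (qhat : ∀ F : T.Face, Lp (E d) 2 (T.faceMeasure F)) {K : T.Cell} {F : T.Face}
    (hF : F ∈ T.facesOf K) : S.elimTrace ρ q u qhat K F = S.PM F (T.toL2 F (u K)) +
      (T.h K / ρ) • (T.toL2 F (T.normalTrace q K F) - T.toL2 F (T.normalComp qhat K F)) := by
  rw [← T.toL2_sub (S.memLp_normalTrace hq K F hF) (T.memLp_normalComp qhat K F)]
  unfold elimTrace
  simp only [inner_sub_left]
  rfl

theorem elimTrace_mem (hS : S.NormalTracesIn) {q : T.Cell → E d → E d} (hq : q ∈ S.Vh)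
    (u : T.Cell → E d → ℝ) {qhat : ∀ F : T.Face, Lp (E d) 2 (T.faceMeasure F)} (hqhat : qhat ∈ S.Nh)
    {K : T.Cell} {F : T.Face} (hF : F ∈ T.facesOf K) : S.elimTrace ρ q u qhat K F ∈ S.M F := by
  rw [elimTrace_eq hq u qhat hF]
  exact (S.M F).add_mem (S.PM_mem F _) ((S.M F).smul_mem _
    ((S.M F).sub_mem (hS K F hF _ (hq K)) (hqhat K F hF)))

/-! ### Single-valuedness of the numerical flux -/

/-- The transmission condition makes the sum of the two one-sided fluxes orthogonal to `M(F)`, while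
the assumption on normal traces puts that sum in `M(F)`. -/
theorem numFlux_add_numFlux_eq_zero (hS : S.NormalTracesIn) {q : T.Cell → E d → E d} (hq : q ∈ S.Vh)
    {u : T.Cell → E d → ℝ} {uhat : ∀ F, T.L2 F}
    (htr : ∀ μ ∈ S.Mh,
      T.facePairInt (T.single μ) (fun K F => numFlux T (S.lsStab ρ) q u uhat K F) = 0)
    {K : T.Cell} {F : T.Face} (hne : T.someCell F ≠ K) (hF : F ∈ T.facesOf K) :
    numFlux T (S.lsStab ρ) q u uhat (T.someCell F) F + numFlux T (S.lsStab ρ) q u uhat K F = 0 := by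
  classical
  have hb : ¬ T.IsBoundary F := fun hb => hne (T.eq_someCell_of_isBoundary hb hF).symm
  obtain ⟨K', hne', hK', h⟩ := T.exists_pair_of_not_isBoundary hb
  have hKK' : K = K' := by
    have : K ∈ Finset.univ.filter fun K => F ∈ T.facesOf K := by simpa using hF
    rw [h, Finset.mem_insert, Finset.mem_singleton] at this
    exact this.resolve_left hne.symm
  subst hKK'
  set g := numFlux T (S.lsStab ρ) q u uhat (T.someCell F) F + numFlux T (S.lsStab ρ) q u uhat K F
    with hg
  have hgM : g ∈ S.M F := (S.M F).add_mem (numFlux_mem hS hq u uhat (T.mem_facesOf_someCell F))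
    (numFlux_mem hS hq u uhat hF)
  -- The test function is the flux sum `g` on `F` and zero on all other faces, which leaves only
  -- `⟨g, g⟩`.
  have key := htr _ (S.update_zero_mem_Mh hgM)
  unfold Mesh.facePairInt at key
  rw [T.facePairOn_eq_sum_inner _ (fun K F _ => T.memLp_single _ K F)
    (fun K F _ => Lp.memLp _), Mesh.sum_facesOf_comm, Finset.sum_eq_single F] at key
  · rw [h, Finset.sum_pair hne'] at key
    simp only [T.toL2_single, T.toL2_coe, Function.update_self] at key
    rw [← inner_add_right, ← hg] at key
    exact inner_self_eq_zero.1 key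
  · intro F' _ hF'
    refine Finset.sum_eq_zero fun K _ => ?_
    simp [T.toL2_single, Function.update_of_ne hF']
  · intro hF'
    exact absurd (by simpa using hb) hF'

/-- The flux seen from one chosen side, times the normal of that side, defines a single-valued
vector; on the other side both flux and normal change sign. -/
theorem exists_isNumFlux (hS : S.NormalTracesIn) {q : T.Cell → E d → E d} (hq : q ∈ S.Vh)
    {u : T.Cell → E d → ℝ} {uhat : ∀ F, T.L2 F}
    (htr : ∀ μ ∈ S.Mh,
      T.facePairInt (T.single μ) (fun K F => numFlux T (S.lsStab ρ) q u uhat K F) = 0) :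
    ∃ qhat ∈ S.Nh, IsNumFlux T (S.lsStab ρ) q u uhat qhat := by
  refine ⟨T.normalLift fun F => numFlux T (S.lsStab ρ) q u uhat (T.someCell F) F,
    S.normalLift_mem_Nh fun F => numFlux_mem hS hq u uhat (T.mem_facesOf_someCell F), ?_⟩
  intro K F hF
  rcases eq_or_ne (T.someCell F) K with h | h
  · rw [← h, T.toL2_normalComp_normalLift_someCell]
  · rw [T.toL2_normalComp_eq_neg _ h (T.mem_facesOf_someCell F) hF,
      T.toL2_normalComp_normalLift_someCell]
    exact neg_eq_of_add_eq_zero_right (numFlux_add_numFlux_eq_zero hS hq htr h hF)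

/-! ### Elimination of the numerical trace -/

/-- Since `P_M` fixes `û_h`, the unknown enters the flux through the scalar `-ρ / h` alone, and `h /
ρ` inverts it. -/
theorem isNumFlux_iff (hρ : 0 < ρ) {q : T.Cell → E d → E d} (hq : q ∈ S.Vh)
    (u : T.Cell → E d → ℝ) {uhat : ∀ F, T.L2 F} (huhat : uhat ∈ S.Mh)
    (qhat : ∀ F : T.Face, Lp (E d) 2 (T.faceMeasure F)) :
    IsNumFlux T (S.lsStab ρ) q u uhat qhat ↔
      ∀ K, ∀ F ∈ T.facesOf K, uhat F = S.elimTrace ρ q u qhat K F := by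
  refine forall_congr' fun K => forall_congr' fun F => forall_congr' fun hF => ?_
  have hh := T.h_pos hF
  rw [elimTrace_eq hq u qhat hF]
  unfold numFlux lsStab
  rw [LinearMap.smul_apply, map_sub, S.PM_eq_self (huhat F)]
  generalize S.PM F (T.toL2 F (u K)) = a
  generalize T.toL2 F (T.normalTrace q K F) = b
  generalize T.toL2 F (T.normalComp qhat K F) = c
  generalize uhat F = e
  have h1 : T.h K / ρ * (ρ / T.h K) = 1 := by field_simp
  have h2 : ρ / T.h K * (T.h K / ρ) = 1 := by field_simp
  constructor
  · rintro rfl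
    rw [sub_add_cancel_left, smul_neg, smul_smul, h1, one_smul]
    abel
  · rintro rfl
    rw [sub_add_cancel_left, smul_neg, smul_smul, h2, one_smul]
    abel

theorem mem_Nh_of_isNumFlux (hS : S.NormalTracesIn) {q : T.Cell → E d → E d} (hq : q ∈ S.Vh)
    {u : T.Cell → E d → ℝ} {uhat : ∀ F, T.L2 F}
    {qhat : ∀ F : T.Face, Lp (E d) 2 (T.faceMeasure F)}
    (h : IsNumFlux T (S.lsStab ρ) q u uhat qhat) : qhat ∈ S.Nh := by
  intro K F hF
  rw [h K F hF]
  exact numFlux_mem hS hq u uhat hF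

variable {c : E d → E d →L[ℝ] E d} {f uD : E d → ℝ} {q : T.Cell → E d → E d}
  {u : T.Cell → E d → ℝ} {uhat : ∀ F, T.L2 F} {qhat : ∀ F : T.Face, Lp (E d) 2 (T.faceMeasure F)}

theorem facePairOn_single_eq_elimTrace
    (h : ∀ K, ∀ F ∈ T.facesOf K, uhat F = S.elimTrace ρ q u qhat K F) (p : T.Face → Prop)
    (b : T.Cell → T.Face → E d → ℝ) :
    T.facePairOn p (T.single uhat) b =
      T.facePairOn p (fun K F => S.elimTrace ρ q u qhat K F) b :=
  T.facePairOn_congr (fun K F hF _ => by rw [← h K F hF]; exact ae_eq_refl _)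
    fun _ _ _ _ => ae_eq_refl _

theorem facePairOn_numFlux_eq (h : IsNumFlux T (S.lsStab ρ) q u uhat qhat) (p : T.Face → Prop)
    (b : T.Cell → T.Face → E d → ℝ) :
    T.facePairOn p (fun K F => numFlux T (S.lsStab ρ) q u uhat K F) b =
      T.facePairOn p (T.normalComp qhat) b :=
  T.facePairOn_congr
    (fun K F hF _ => by rw [← h K F hF]; exact T.coeFn_toL2_normalComp qhat K F)
    fun _ _ _ _ => ae_eq_refl _

theorem isHDGSolution_iff_isRewrittenSolution (hS : S.NormalTracesIn) (hρ : 0 < ρ)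
    (hq : q ∈ S.Vh) (hu : u ∈ S.Wh) (huhat : uhat ∈ S.Mh)
    (h : IsNumFlux T (S.lsStab ρ) q u uhat qhat) :
    S.IsHDGSolution (S.lsStab ρ) c f uD q u uhat ↔ S.IsRewrittenSolution ρ c f uD q u qhat := by
  have he := (isNumFlux_iff hρ hq u huhat qhat).1 h
  have hqhat := mem_Nh_of_isNumFlux hS hq h
  constructor
  · intro H
    refine ⟨hq, hu, hqhat, fun v hv => ?_, fun w hw => ?_, fun ν hν => ?_⟩
    · rw [← H.eq_q v hv]
      unfold Mesh.facePair
      rw [facePairOn_single_eq_elimTrace he]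
    · rw [← H.eq_u w hw]
      unfold Mesh.facePair
      rw [facePairOn_numFlux_eq h]
    -- As `û_h` is single-valued, it cancels against `ν · n` on interior faces, leaving the boundary
    -- pairing.
    · have h1 : T.facePair (fun K F => S.elimTrace ρ q u qhat K F) (T.normalComp ν) =
          T.facePairBdry (T.single uhat) (T.normalComp ν) := by
        rw [← T.facePair_single_normalComp]
        unfold Mesh.facePair
        rw [facePairOn_single_eq_elimTrace he]
      have h2 := H.eq_boundary _ (S.someNormalComp_mem_Mh hν)
      have h3 : ∀ a, T.facePairBdry (T.single (T.someNormalComp ν)) a =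
          T.facePairBdry a (T.normalComp ν) := by
        intro a
        unfold Mesh.facePairBdry
        rw [T.facePairOn_comm]
        exact T.facePairOn_congr (fun _ _ _ _ => ae_eq_refl _)
          fun K F hF hb => T.someNormalComp_of_isBoundary ν hF hb
      rw [h1, ← h3, h2, h3]
  · intro H
    refine ⟨hq, hu, huhat, fun v hv => ?_, fun w hw => ?_, fun μ hμ => ?_, fun μ hμ => ?_⟩
    · rw [← H.eq_q v hv]
      unfold Mesh.facePair
      rw [facePairOn_single_eq_elimTrace he]
    · rw [← H.eq_u w hw]
      unfold Mesh.facePair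
      rw [facePairOn_numFlux_eq h]
    -- The transmission condition is automatic here: the flux is the normal component of the
    -- single-valued `q̂_h`.
    · unfold Mesh.facePairInt
      rw [T.facePairOn_comm, facePairOn_numFlux_eq h, T.facePairOn_comm]
      exact T.facePairInt_single_normalComp μ qhat
    -- A boundary face has only one adjacent element, so the normal component of `normalLift μ` is
    -- `μ` there, with no sign ambiguity.
    · have h3 : ∀ a, T.facePairBdry (T.single μ) a =
          T.facePairBdry a (T.normalComp (T.normalLift μ)) := by
        intro a
        unfold Mesh.facePairBdry
        rw [T.facePairOn_comm]
        exact T.facePairOn_congr (fun _ _ _ _ => ae_eq_refl _)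
          fun K F hF hb => (T.normalComp_normalLift_of_isBoundary μ hF hb).symm
      rw [h3, h3, ← H.eq_transmission _ (S.normalLift_mem_Nh hμ), ← T.facePair_single_normalComp]
      unfold Mesh.facePair
      rw [facePairOn_single_eq_elimTrace he]

/-- For a solution of the rewritten system, `P_M u_h + (h / ρ) (q_h - q̂_h) · n` is single-valued. -/
theorem IsRewrittenSolution.elimTrace_eq_someCell (hS : S.NormalTracesIn)
    (H : S.IsRewrittenSolution ρ c f uD q u qhat) {K : T.Cell} {F : T.Face}
    (hF : F ∈ T.facesOf K) :
    S.elimTrace ρ q u qhat (T.someCell F) F = S.elimTrace ρ q u qhat K F := by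
  classical
  rcases eq_or_ne (T.someCell F) K with rfl | hne
  · rfl
  have hb : ¬ T.IsBoundary F := fun hb => hne (T.eq_someCell_of_isBoundary hb hF).symm
  obtain ⟨K', hne', hK', h⟩ := T.exists_pair_of_not_isBoundary hb
  have hKK' : K = K' := by
    have : K ∈ Finset.univ.filter fun K => F ∈ T.facesOf K := by simpa using hF
    rw [h, Finset.mem_insert, Finset.mem_singleton] at this
    exact this.resolve_left hne.symm
  subst hKK'
  set g := S.elimTrace ρ q u qhat (T.someCell F) F - S.elimTrace ρ q u qhat K F with hg
  have hgM : g ∈ S.M F := (S.M F).sub_mem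
    (elimTrace_mem hS H.q_mem u H.qhat_mem (T.mem_facesOf_someCell F))
    (elimTrace_mem hS H.q_mem u H.qhat_mem hF)
  -- The jump `g` is used as normal component on `F` alone. The face is interior, so the `u_D` term
  -- vanishes, and the opposite normals leave `⟨g, g⟩ = 0`.
  set ν := T.normalLift (Function.update 0 F g) with hν
  have key := H.eq_transmission ν (S.normalLift_mem_Nh (S.update_zero_mem_Mh hgM))
  have h0 : T.facePairBdry (fun _ _ => uD) (T.normalComp ν) = 0 := by
    have h1 : T.facePairBdry (fun _ _ => uD) (T.normalComp ν) =
        T.facePairBdry (fun _ _ => uD) (T.normalComp 0) := by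
      refine T.facePairOn_congr (fun _ _ _ _ => ae_eq_refl _) fun K F' hF' hb' => ?_
      have hne : F' ≠ F := by
        rintro rfl
        exact hb hb'
      refine (T.normalComp_normalLift_of_isBoundary _ hF' hb').trans ?_
      rw [Function.update_of_ne hne]
      exact (Lp.coeFn_zero _ _ _).trans (T.normalComp_zero K F').symm
    rw [h1]
    exact T.facePairOn_normalComp_zero _ _
  unfold Mesh.facePair at key
  rw [h0, T.facePairOn_eq_sum_inner _ (fun K F _ => Lp.memLp _)
    (fun K F _ => T.memLp_normalComp _ K F), Mesh.sum_facesOf_comm, Finset.sum_eq_single F] at key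
  · rw [h, Finset.sum_pair hne', T.toL2_normalComp_eq_neg ν hne (T.mem_facesOf_someCell F) hF] at key
    simp only [T.toL2_coe, hν, T.toL2_normalComp_normalLift_someCell, Function.update_self] at key
    rw [inner_neg_right, ← sub_eq_add_neg, ← inner_sub_left, ← hg] at key
    exact sub_eq_zero.1 (inner_self_eq_zero.1 key)
  · intro F' _ hF'
    refine Finset.sum_eq_zero fun K _ => ?_
    simp [hν, T.toL2_normalComp_normalLift, Function.update_of_ne hF']
  · intro hF'
    exact absurd (by simp) hF'

/-- The elimination formula, now known to be single-valued, supplies `û_h`; every face belongs to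
some element, so the formula also forces uniqueness. -/
theorem IsRewrittenSolution.existsUnique_uhat (hS : S.NormalTracesIn) (hρ : 0 < ρ)
    (H : S.IsRewrittenSolution ρ c f uD q u qhat) :
    ∃! uhat, S.IsHDGSolution (S.lsStab ρ) c f uD q u uhat ∧
      IsNumFlux T (S.lsStab ρ) q u uhat qhat := by
  have hmem : (fun F => S.elimTrace ρ q u qhat (T.someCell F) F) ∈ S.Mh := fun F =>
    elimTrace_mem hS H.q_mem u H.qhat_mem (T.mem_facesOf_someCell F)
  have hnf : IsNumFlux T (S.lsStab ρ) q u
      (fun F => S.elimTrace ρ q u qhat (T.someCell F) F) qhat :=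
    (isNumFlux_iff hρ H.q_mem u hmem qhat).2 fun K F hF => H.elimTrace_eq_someCell hS hF
  refine ⟨_, ⟨(isHDGSolution_iff_isRewrittenSolution hS hρ H.q_mem H.u_mem hmem hnf).2 H, hnf⟩, ?_⟩
  rintro uhat' ⟨h1, h2⟩
  funext F
  exact (isNumFlux_iff hρ H.q_mem u h1.uhat_mem qhat).1 h2 _ F (T.mem_facesOf_someCell F)

/-! ### The two-equation form -/

theorem stabForm_eq_sum_inner (hq : q ∈ S.Vh) (qhat : ∀ F : T.Face, Lp (E d) 2 (T.faceMeasure F))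
    {v : T.Cell → E d → E d} (hv : v ∈ S.Vh) (ν : ∀ F : T.Face, Lp (E d) 2 (T.faceMeasure F)) :
    stabForm T ρ q qhat v ν = ∑ K, ∑ F ∈ T.facesOf K, inner ℝ
      ((T.h K / ρ) • (T.toL2 F (T.normalTrace q K F) - T.toL2 F (T.normalComp qhat K F)))
      (T.toL2 F (T.normalTrace v K F) - T.toL2 F (T.normalComp ν K F)) := by
  have hm : ∀ {q : T.Cell → E d → E d} (_ : q ∈ S.Vh)
      (qhat : ∀ F : T.Face, Lp (E d) 2 (T.faceMeasure F)), ∀ K, ∀ F ∈ T.facesOf K,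
      MemLp (fun x => inner ℝ (q K x - qhat F x) (T.normal K F)) 2 (T.faceMeasure F) ∧
      T.toL2 F (fun x => inner ℝ (q K x - qhat F x) (T.normal K F)) =
        T.toL2 F (T.normalTrace q K F) - T.toL2 F (T.normalComp qhat K F) := by
    intro q hq qhat K F hF
    rw [← T.toL2_sub (S.memLp_normalTrace hq K F hF) (T.memLp_normalComp qhat K F)]
    simp only [inner_sub_left]
    exact ⟨(S.memLp_normalTrace hq K F hF).sub (T.memLp_normalComp qhat K F), rfl⟩
  unfold stabForm
  rw [T.facePair_eq_sum_inner (fun K F hF => (hm hq qhat K F hF).1.const_mul _)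
    fun K F hF => (hm hv ν K F hF).1]
  refine Finset.sum_congr rfl fun K _ => Finset.sum_congr rfl fun F hF => ?_
  rw [T.toL2_const_mul _ (hm hq qhat K F hF).1, (hm hq qhat K F hF).2, (hm hv ν K F hF).2]

/-- Both `v · n` and `ν · n` lie in `M(F)`, so `u_h` may be replaced by `P_M u_h`; the stabilization
then completes it to the eliminated trace. -/
theorem stabForm_add_facePair_trace (hS : S.NormalTracesIn) (hq : q ∈ S.Vh) (hu : u ∈ S.Wh)
    (qhat : ∀ F : T.Face, Lp (E d) 2 (T.faceMeasure F)) {v : T.Cell → E d → E d} (hv : v ∈ S.Vh)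
    {ν : ∀ F : T.Face, Lp (E d) 2 (T.faceMeasure F)} (hν : ν ∈ S.Nh) :
    stabForm T ρ q qhat v ν + T.facePair (T.trace u) (T.normalTrace v)
        - T.facePair (T.trace u) (T.normalComp ν) =
      T.facePair (fun K F => S.elimTrace ρ q u qhat K F) (T.normalTrace v)
        - T.facePair (fun K F => S.elimTrace ρ q u qhat K F) (T.normalComp ν) := by
  rw [stabForm_eq_sum_inner hq qhat hv ν,
    T.facePair_eq_sum_inner (S.memLp_trace hu) (S.memLp_normalTrace hv),
    T.facePair_eq_sum_inner (S.memLp_trace hu) (fun K F _ => T.memLp_normalComp ν K F),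
    T.facePair_eq_sum_inner (fun K F _ => Lp.memLp _) (S.memLp_normalTrace hv),
    T.facePair_eq_sum_inner (fun K F _ => Lp.memLp _) (fun K F _ => T.memLp_normalComp ν K F)]
  simp only [← Finset.sum_add_distrib, ← Finset.sum_sub_distrib]
  refine Finset.sum_congr rfl fun K _ => Finset.sum_congr rfl fun F hF => ?_
  have hvM : T.toL2 F (T.normalTrace v K F) ∈ S.M F := hS K F hF _ (hv K)
  rw [T.toL2_coe, elimTrace_eq hq u qhat hF, inner_add_left, inner_add_left,
    S.inner_PM_left _ hvM, S.inner_PM_left _ (hν K F hF), inner_sub_right]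
  unfold Mesh.trace
  ring

/-- Integration by parts together with the preceding face identity exhibits the left-hand side as
the first rewritten equation minus the third. -/
theorem final_lhs_eq (hS : S.NormalTracesIn) (hq : q ∈ S.Vh) (hu : u ∈ S.Wh)
    (qhat : ∀ F : T.Face, Lp (E d) 2 (T.faceMeasure F)) {v : T.Cell → E d → E d} (hv : v ∈ S.Vh)
    {ν : ∀ F : T.Face, Lp (E d) 2 (T.faceMeasure F)} (hν : ν ∈ S.Nh) :
    (T.volPairVec (fun K x => c x (q K x)) v + stabForm T ρ q qhat v ν)
        - (- T.volPairVec (grad u) v + T.facePair (T.trace u) (T.normalComp ν)) =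
      (T.volPairVec (fun K x => c x (q K x)) v - T.volPair u (dvg v)
        + T.facePair (fun K F => S.elimTrace ρ q u qhat K F) (T.normalTrace v))
        - T.facePair (fun K F => S.elimTrace ρ q u qhat K F) (T.normalComp ν) := by
  have h1 := T.volPair_dvg_add_volPairVec_grad (fun K => S.W_contDiffAt K _ (hu K))
    (fun K => S.V_contDiffAt K _ (hv K))
  have h2 := stabForm_add_facePair_trace (ρ := ρ) hS hq hu qhat hv hν
  linarith

theorem isRewrittenSolution_iff_isFinalSolution (hS : S.NormalTracesIn) :
    S.IsRewrittenSolution ρ c f uD q u qhat ↔ S.IsFinalSolution ρ c f uD q u qhat := by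
  constructor
  · intro H
    refine ⟨H.q_mem, H.u_mem, H.qhat_mem, fun v hv ν hν => ?_, H.eq_u⟩
    rw [final_lhs_eq hS H.q_mem H.u_mem qhat hv hν, H.eq_q v hv, H.eq_transmission ν hν, zero_sub]
  · intro H
    have hz := S.zero_mem_Nh
    have hq0 : ∀ v ∈ S.Vh, T.volPairVec (fun K x => c x (q K x)) v - T.volPair u (dvg v)
        + T.facePair (fun K F => S.elimTrace ρ q u qhat K F) (T.normalTrace v) = 0 := by
      intro v hv
      have h := H.eq_q v hv 0 hz
      rw [final_lhs_eq hS H.q_mem H.u_mem qhat hv hz] at h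
      unfold Mesh.facePair Mesh.facePairBdry at h
      rw [T.facePairOn_normalComp_zero, T.facePairOn_normalComp_zero, sub_zero, neg_zero] at h
      exact h
    refine ⟨H.q_mem, H.u_mem, H.qhat_mem, hq0, H.eq_u, fun ν hν => ?_⟩
    -- Any element of `V_h` serves as `v`, since the first equation, obtained from `ν = 0`, already
    -- removes its contribution; `q` is at hand.
    have h := H.eq_q q H.q_mem ν hν
    rw [final_lhs_eq hS H.q_mem H.u_mem qhat H.q_mem hν, hq0 q H.q_mem, zero_sub, neg_inj] at h
    exact h

end LocalSpaces

/-! ### Polynomial spaces -/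

/-- Analyticity supplies the identity principle: a polynomial vanishing on an open subset of an
element vanishes everywhere. -/
theorem analyticOnNhd_of_mem_polySpace {k : ℕ} {p : E d → ℝ} (hp : p ∈ polySpace d k) :
    AnalyticOnNhd ℝ p univ := by
  obtain ⟨P, -, rfl⟩ := hp
  induction P using MvPolynomial.induction_on with
  | C a =>
    simp only [AlgHom.toLinearMap_apply, MvPolynomial.aeval_C]
    exact analyticOnNhd_const
  | add p q hp hq =>
    simp only [AlgHom.toLinearMap_apply, map_add] at hp hq ⊢
    exact hp.add hq
  | mul_X p i hp =>
    simp only [AlgHom.toLinearMap_apply, map_mul, MvPolynomial.aeval_X] at hp ⊢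
    exact hp.mul ((EuclideanSpace.proj i : E d →L[ℝ] ℝ).analyticOnNhd univ)

/-- The normal is constant on a flat face, so `v · n` is a constant-coefficient combination of the
components of `v` and has no higher degree. -/
theorem polySpaces_normalTracesIn (T : Mesh d Ω) (k : ℕ) : (polySpaces T k).NormalTracesIn := by
  intro K F hF v hv
  have hmem : (fun x => (inner ℝ (v x) (T.normal K F) : ℝ)) ∈ polySpace d k := by
    have : (fun x => (inner ℝ (v x) (T.normal K F) : ℝ)) =
        ∑ i, T.normal K F i • fun x => v x i := by
      funext x
      simp [PiLp.inner_apply, Finset.sum_apply]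
    rw [this]
    exact Submodule.sum_mem _ fun i _ => Submodule.smul_mem _ _ (hv i)
  exact ⟨_, hmem, T.coeFn_toL2
    (T.memLp_faceMeasure_of_continuousOn (polySpace_contDiff hmem).continuous.continuousOn)⟩

namespace Mesh

/-- A polynomial whose square has zero integral over an element vanishes. -/
theorem eq_zero_of_integral_sq_eq_zero (T : Mesh d Ω) (K : T.Cell) {k : ℕ} {p : E d → ℝ}
    (hp : p ∈ polySpace d k) (h : ∫ x in T.cell K, p x * p x = 0) : p = 0 := by
  have hc : Continuous p := (polySpace_contDiff hp).continuous
  have hKc := T.cell_isCompact K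
  have hint : IntegrableOn (fun x => p x * p x) (T.cell K) :=
    (hc.mul hc).continuousOn.integrableOn_compact hKc
  have hae := (setIntegral_eq_zero_iff_of_nonneg_ae
    (Filter.Eventually.of_forall fun x => mul_self_nonneg (p x)) hint).1 h
  have hne : (interior (T.cell K)).Nonempty := by
    rw [← closure_nonempty_iff, ← T.cell_eq_closure K]
    exact T.cell_nonempty K
  obtain ⟨x, hx⟩ := hne
  -- Passing to the open interior lets continuity upgrade almost everywhere vanishing to vanishing
  -- at every point.
  have hae' : (fun x => p x * p x) =ᵐ[volume.restrict (interior (T.cell K))] fun _ => 0 :=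
    ae_restrict_of_ae_restrict_of_subset interior_subset hae
  have heq := Measure.eqOn_open_of_ae_eq hae' isOpen_interior (hc.mul hc).continuousOn
    continuousOn_const
  refine (analyticOnNhd_of_mem_polySpace hp).eq_of_eventuallyEq (z₀ := x)
    (fun _ _ => analyticAt_const) ?_
  filter_upwards [isOpen_interior.mem_nhds hx] with y hy
  exact mul_self_eq_zero.1 (heq hy)

theorem integrableOn_cell_mul (T : Mesh d Ω) (K : T.Cell) {a b : E d → ℝ}
    (ha : Continuous a) (hb : Continuous b) : IntegrableOn (fun x => a x * b x) (T.cell K) :=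
  (ha.mul hb).continuousOn.integrableOn_compact (T.cell_isCompact K)

/-- Every linear functional on `𝒫_k` is represented by the `L²(K)` inner product with a
polynomial. -/
theorem exists_integral_mul_eq (T : Mesh d Ω) (K : T.Cell) {k : ℕ}
    (ℓ : polySpace d k →ₗ[ℝ] ℝ) :
    ∃ D ∈ polySpace d k, ∀ φ : polySpace d k,
      ∫ x in T.cell K, D x * (φ : E d → ℝ) x = ℓ φ := by
  have := polySpace_finite d k
  have hc : ∀ p : polySpace d k, Continuous (p : E d → ℝ) := fun p =>
    (polySpace_contDiff p.2).continuous
  let B : polySpace d k →ₗ[ℝ] Module.Dual ℝ (polySpace d k) :=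
    LinearMap.mk₂ ℝ (fun a b => ∫ x in T.cell K, (a : E d → ℝ) x * (b : E d → ℝ) x)
      (fun a a' b => by
        rw [← integral_add (T.integrableOn_cell_mul K (hc a) (hc b))
          (T.integrableOn_cell_mul K (hc a') (hc b))]
        simp [add_mul])
      (fun r a b => by
        rw [smul_eq_mul, ← integral_const_mul]
        simp [mul_assoc])
      (fun a b b' => by
        rw [← integral_add (T.integrableOn_cell_mul K (hc a) (hc b))
          (T.integrableOn_cell_mul K (hc a) (hc b'))]
        simp [mul_add])
      (fun r a b => by
        rw [smul_eq_mul, ← integral_const_mul]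
        simp [mul_left_comm])
  have hinj : Function.Injective B := by
    rw [← LinearMap.ker_eq_bot, LinearMap.ker_eq_bot']
    intro a ha
    exact Subtype.ext (T.eq_zero_of_integral_sq_eq_zero K a.2 (LinearMap.congr_fun ha a))
  -- In finite dimension an injective map to the dual is onto.
  have hsurj : Function.Surjective B :=
    (LinearMap.injective_iff_surjective_of_finrank_eq_finrank Subspace.dual_finrank_eq.symm).1 hinj
  obtain ⟨D, hD⟩ := hsurj ℓ
  exact ⟨D, D.2, fun φ => LinearMap.congr_fun hD φ⟩

end Mesh

/-! ### The discrete weak divergence -/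

/-- The right-hand side of the definition is a linear functional of the test polynomial, hence
represented by some `D`. -/
theorem exists_isWeakDiv (T : Mesh d Ω) (k : ℕ) (K : T.Cell) {v₀ : E d → E d}
    (hv₀ : Continuous v₀) (vb : ∀ F : T.Face, Lp (E d) 2 (T.faceMeasure F)) :
    ∃ D, IsWeakDiv T k K v₀ vb D := by
  have hc1 : ∀ p : polySpace d (k + 1), ContDiff ℝ 1 (p : E d → ℝ) := fun p =>
    polySpace_contDiff p.2
  have hd : ∀ (p : polySpace d (k + 1)) x, DifferentiableAt ℝ (p : E d → ℝ) x := fun p =>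
    (hc1 p).differentiable one_ne_zero
  have hi1 : ∀ p : polySpace d (k + 1),
      IntegrableOn (fun x => (inner ℝ (v₀ x) (gradient (p : E d → ℝ) x) : ℝ)) (T.cell K) := by
    intro p
    refine ContinuousOn.integrableOn_compact (T.cell_isCompact K) (Continuous.continuousOn ?_)
    exact hv₀.inner ((InnerProductSpace.toDual ℝ (E d)).symm.continuous.comp
      ((hc1 p).continuous_fderiv one_ne_zero))
  have hi2 : ∀ (p : polySpace d (k + 1)) F,
      Integrable (fun x => T.normalComp vb K F x * (p : E d → ℝ) x) (T.faceMeasure F) := fun p F =>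
    (T.memLp_normalComp vb K F).integrable_mul
      (T.memLp_faceMeasure_of_continuousOn (hc1 p).continuous.continuousOn)
  let ℓ : polySpace d (k + 1) →ₗ[ℝ] ℝ :=
    { toFun := fun p => - (∫ x in T.cell K, inner ℝ (v₀ x) (gradient (p : E d → ℝ) x))
        + ∑ F ∈ T.facesOf K, ∫ x, T.normalComp vb K F x * (p : E d → ℝ) x ∂(T.faceMeasure F)
      map_add' := fun p q => by
        have h1 : ∀ x, gradient ((p + q : polySpace d (k + 1)) : E d → ℝ) x =
            gradient (p : E d → ℝ) x + gradient (q : E d → ℝ) x := fun x => by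
          simp only [gradient, Submodule.coe_add]
          rw [fderiv_add (hd p x) (hd q x), map_add]
        simp_rw [h1, inner_add_right, Submodule.coe_add, Pi.add_apply, mul_add]
        rw [integral_add (hi1 p) (hi1 q), Finset.sum_congr rfl fun F _ =>
          integral_add (hi2 p F) (hi2 q F), Finset.sum_add_distrib]
        ring
      map_smul' := fun r p => by
        have h1 : ∀ x, gradient ((r • p : polySpace d (k + 1)) : E d → ℝ) x =
            r • gradient (p : E d → ℝ) x := fun x => by
          simp only [gradient, Submodule.coe_smul]
          rw [fderiv_const_smul (hd p x), map_smul]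
        simp_rw [h1, inner_smul_right, Submodule.coe_smul, Pi.smul_apply, smul_eq_mul,
          mul_left_comm _ r, integral_const_mul, ← Finset.mul_sum]
        simp only [RingHom.id_apply]
        ring }
  obtain ⟨D, hD, h⟩ := T.exists_integral_mul_eq K ℓ
  exact ⟨D, hD, fun φ hφ => h ⟨φ, hφ⟩⟩

theorem IsWeakDiv.unique {T : Mesh d Ω} {k : ℕ} {K : T.Cell} {v₀ : E d → E d}
    {vb : ∀ F : T.Face, Lp (E d) 2 (T.faceMeasure F)} {D D' : E d → ℝ}
    (hD : IsWeakDiv T k K v₀ vb D) (hD' : IsWeakDiv T k K v₀ vb D') : D = D' := by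
  have hsub := (polySpace d (k + 1)).sub_mem hD.1 hD'.1
  have hc := (polySpace_contDiff hsub).continuous
  have h := (hD.2 _ hsub).trans (hD'.2 _ hsub).symm
  rw [← sub_eq_zero, ← integral_sub
    (T.integrableOn_cell_mul K (polySpace_contDiff hD.1).continuous hc)
    (T.integrableOn_cell_mul K (polySpace_contDiff hD'.1).continuous hc)] at h
  refine sub_eq_zero.1 (T.eq_zero_of_integral_sq_eq_zero K hsub ?_)
  rw [← h]
  simp [sub_mul]

theorem isWeakDiv_weakDiv (T : Mesh d Ω) (k : ℕ) {v₀ : T.Cell → E d → E d}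
    (hv₀ : ∀ K, Continuous (v₀ K)) (vb : ∀ F : T.Face, Lp (E d) 2 (T.faceMeasure F)) (K : T.Cell) :
    IsWeakDiv T k K (v₀ K) vb (weakDiv T k v₀ vb K) := by
  have h := exists_isWeakDiv T k K (hv₀ K) vb
  simp only [weakDiv, dif_pos h]
  exact h.choose_spec

theorem volPair_weakDiv (T : Mesh d Ω) (k : ℕ) {v₀ : T.Cell → E d → E d}
    (hv₀ : ∀ K, Continuous (v₀ K)) (vb : ∀ F : T.Face, Lp (E d) 2 (T.faceMeasure F))
    {w : T.Cell → E d → ℝ} (hw : ∀ K, w K ∈ polySpace d (k + 1)) :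
    T.volPair (weakDiv T k v₀ vb) w =
      - T.volPairVec v₀ (grad w) + T.facePair (T.normalComp vb) (T.trace w) := by
  rw [T.facePair_eq_sum]
  unfold Mesh.volPair Mesh.volPairVec
  rw [← Finset.sum_neg_distrib, ← Finset.sum_add_distrib]
  exact Finset.sum_congr rfl fun K _ => (isWeakDiv_weakDiv T k hv₀ vb K).2 _ (hw K)

/-- The weak divergence occurs only in pairings with elements of `W_h`, exactly the functions
allowed in its definition, so each occurrence can be replaced by the face and gradient terms. -/
theorem isFinalSolution_iff_isWGSolution (T : Mesh d Ω) (k : ℕ) {ρ : ℝ}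
    {c : E d → E d →L[ℝ] E d} {f uD : E d → ℝ} {q : T.Cell → E d → E d} {u : T.Cell → E d → ℝ}
    {qhat : ∀ F : T.Face, Lp (E d) 2 (T.faceMeasure F)} :
    (polySpaces T k).IsFinalSolution ρ c f uD q u qhat ↔ IsWGSolution T k ρ c f uD q qhat u := by
  have hcont : ∀ {v : T.Cell → E d → E d}, (∀ K, v K ∈ polyVecSpace d k) →
      ∀ K, Continuous (v K) := fun hv K => (polyVecSpace_contDiff (hv K)).continuous
  have hsymm : ∀ (v : T.Cell → E d → E d) (ν : ∀ F : T.Face, Lp (E d) 2 (T.faceMeasure F))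
      (u : T.Cell → E d → ℝ),
      - T.volPairVec v (grad u) + T.facePair (T.normalComp ν) (T.trace u) =
        - T.volPairVec (grad u) v + T.facePair (T.trace u) (T.normalComp ν) := by
    intro v ν u
    unfold Mesh.facePair Mesh.volPairVec
    rw [T.facePairOn_comm]
    simp only [real_inner_comm]
  constructor
  · intro H
    refine ⟨H.q_mem, H.qhat_mem, H.u_mem, fun v ν hv hν => ?_, fun w hw => ?_⟩
    · rw [volPair_weakDiv T k (hcont hv) ν H.u_mem, hsymm]
      exact H.eq_q v hv ν hν
    · rw [volPair_weakDiv T k (hcont H.q_mem) qhat hw]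
      exact H.eq_u w hw
  · intro H
    refine ⟨H.q₀_mem, H.u_mem, H.qb_mem, fun v hv ν hν => ?_, fun w hw => ?_⟩
    · rw [← hsymm, ← volPair_weakDiv T k (hcont hv) ν H.u_mem]
      exact H.eq_q v ν hv hν
    · rw [← volPair_weakDiv T k (hcont H.q₀_mem) qhat hw]
      exact H.eq_u w hw

end HDG

end

/-! ### Assembly of parts (A) and (B) -/

theorem mainTheorem2 {d : ℕ} {Ω : Set (HDG.E d)} (T : HDG.Mesh d Ω)
    (c : HDG.E d → HDG.E d →L[ℝ] HDG.E d) (f uD : HDG.E d → ℝ)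
    (hc : IntegrableOn c Ω) (hf : IntegrableOn f Ω)
    (huD : MemLp uD 2
      ((Measure.euclideanHausdorffMeasure (d - 1) : Measure (HDG.E d)).restrict (frontier Ω)))
    (ρ : ℝ) (hρ : 0 < ρ) :
    (∀ S : HDG.LocalSpaces T, S.NormalTracesIn →
      -- the numerical flux of an HDG solution is given by a single-valued element of `N_h`
      (∀ q u uhat, S.IsHDGSolution (S.lsStab ρ) c f uD q u uhat →
        ∃ qhat ∈ S.Nh, HDG.IsNumFlux T (S.lsStab ρ) q u uhat qhat) ∧
      -- elimination of `û_h`, and equivalence with the rewritten system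
      (∀ q ∈ S.Vh, ∀ u ∈ S.Wh, ∀ uhat ∈ S.Mh, ∀ qhat,
        (HDG.IsNumFlux T (S.lsStab ρ) q u uhat qhat ↔
          ∀ K, ∀ F ∈ T.facesOf K, uhat F = S.elimTrace ρ q u qhat K F) ∧
        (HDG.IsNumFlux T (S.lsStab ρ) q u uhat qhat →
          qhat ∈ S.Nh ∧ (S.IsHDGSolution (S.lsStab ρ) c f uD q u uhat ↔
            S.IsRewrittenSolution ρ c f uD q u qhat))) ∧
      -- each solution of the rewritten system comes from exactly one HDG solution
      (∀ q u qhat, S.IsRewrittenSolution ρ c f uD q u qhat →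
        ∃! uhat, S.IsHDGSolution (S.lsStab ρ) c f uD q u uhat ∧
          HDG.IsNumFlux T (S.lsStab ρ) q u uhat qhat) ∧
      -- the rewritten system is equivalent to its final, two-equation form
      (∀ q u qhat, S.IsRewrittenSolution ρ c f uD q u qhat ↔
        S.IsFinalSolution ρ c f uD q u qhat)) ∧
    -- for `[𝒫_k]^d × 𝒫_{k+1} × 𝒫_k` the final form is the Wang–Ye scheme
    (∀ k : ℕ, (HDG.polySpaces T k).NormalTracesIn ∧
      (∀ q ∈ (HDG.polySpaces T k).Vh, ∀ qhat ∈ (HDG.polySpaces T k).Nh, ∀ K,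
        (∃ D, HDG.IsWeakDiv T k K (q K) qhat D) ∧
        ∀ D D', HDG.IsWeakDiv T k K (q K) qhat D → HDG.IsWeakDiv T k K (q K) qhat D' → D = D') ∧
      (∀ q u qhat, (HDG.polySpaces T k).IsFinalSolution ρ c f uD q u qhat ↔
        HDG.IsWGSolution T k ρ c f uD q qhat u)) := by
  refine ⟨fun S hS => ⟨fun q u uhat H => ?_, fun q hq u hu uhat huhat qhat => ⟨?_, fun h => ⟨?_, ?_⟩⟩,
    fun q u qhat H => ?_, fun q u qhat => ?_⟩, fun k => ⟨?_, fun q hq qhat _ K => ⟨?_, ?_⟩,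
    fun q u qhat => ?_⟩⟩
  · exact HDG.LocalSpaces.exists_isNumFlux hS H.q_mem H.eq_transmission
  · exact HDG.LocalSpaces.isNumFlux_iff hρ hq u huhat qhat
  · exact HDG.LocalSpaces.mem_Nh_of_isNumFlux hS hq h
  · exact HDG.LocalSpaces.isHDGSolution_iff_isRewrittenSolution hS hρ hq hu huhat h
  · exact H.existsUnique_uhat hS hρ
  · exact HDG.LocalSpaces.isRewrittenSolution_iff_isFinalSolution hS
  · exact HDG.polySpaces_normalTracesIn T k
  · exact HDG.exists_isWeakDiv T k K (HDG.polyVecSpace_contDiff (hq K)).continuous qhat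
  · exact fun D D' hD hD' => hD.unique hD'
  · exact HDG.isFinalSolution_iff_isWGSolution T k
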